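/- Let $\alpha\in(0,\infty)$ and let $g:\mathbb R\to[0,1]$ be measurable and symmetric ($g(-x)=g(x)$) with $\lim_{|x|\to\infty} g(x)/|x|^{-\alpha}=1$. Let $\mathcal P$ be a homogeneous Poisson point process on $\mathbb R$ with unit intensity and, for $n\in\mathbb N$, let $\mathcal P_n=\mathcal P\cap[-n,n]$. Let $(\mathcal P_n,E_n)$ be the soft random geometric graph with connection function $g$: given $\mathcal P_n$, each pair of distinct points $x,y\in\mathcal P_n$ is joined by an edge $\{x,y\}\in E_n$ with probability $g(x-y)$, independently of all other pairs. Let $e_n^*=\max_{\{x,y\}\in E_n}|x-y|$ be the length of the longest edge (with $e_n^*=0$ if there is no edge). For $r\in(0,1)$ put $g_r=\exp(-\sqrt{-8\ln r})$ and $c_r=h^{-1}(r^{-1/2})$, where $h:(0,2]\to[1,\infty)$ is the bijection $h(x)=\frac x2\exp\left(\frac{2-x}{x}\right)$, and for $n\in\mathbb N$, large enough that the bases of the powers below are positive, $$r_n=\begin{cases}(2n)^{\frac1{\alpha-1}}\left(\frac{1-\alpha}2\ln r\right)^{\frac1{1-\alpha}},&\alpha>2,\\ c_r\,n,&\alpha=2,\\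 \left((2n)^{2-\alpha}-(2-\alpha)2^{1-\frac\alpha2}\sqrt{-\ln r}\;n^{1-\frac\alpha2}\right)^{\frac1{2-\alpha}},&1<\alpha<2,\\ 2n\,g_r^{\frac1{4\sqrt n}},&\alpha=1,\\ \left((2n)^{1-\alpha}-(1-\alpha)2^{-\frac\alpha2}\sqrt{-\ln r}\;n^{-\frac\alpha2}\right)^{\frac1{1-\alpha}},&0<\alpha<1.\end{cases}$$ Then, for every $\alpha\in(0,\infty)$ and every $r\in(0,1)$, $$\lim_{n\to\infty}\mathbb P\left(e_n^*\le r_n\right)=r^{1/2}.$$ -/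

import Mathlib

open MeasureTheory ProbabilityTheory Filter Topology
open scoped ENNReal

/-- `N : Ω → Set X` is a (simple) Poisson point process with intensity measure `ν`:
the number of points in a measurable set `B` of finite intensity is a Poisson random variable
with mean `ν B`, and the numbers of points in finitely many pairwise disjoint such sets are
independent. -/
structure IsPoissonProcess {Ω X : Type*} [MeasurableSpace Ω] [MeasurableSpace X]
    (N : Ω → Set X) (ν : Measure X) (μ : Measure Ω) : Prop where
  measurable_count : ∀ B : Set X, MeasurableSet B → ν B < ∞ →
    Measurable (fun ω => (N ω ∩ B).encard)
  map_count : ∀ B : Set X, MeasurableSet B → ν B < ∞ →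
    μ.map (fun ω => (N ω ∩ B).encard) =
      (poissonMeasure (ν B).toNNReal).map (fun k : ℕ => (k : ℕ∞))
  indep_count : ∀ (m : ℕ) (B : Fin m → Set X), (∀ i, MeasurableSet (B i)) →
    (∀ i, ν (B i) < ∞) → Pairwise (fun i j => Disjoint (B i) (B j)) →
    iIndepFun (fun (i : Fin m) ω => (N ω ∩ B i).encard) μ

/-- The usual σ-algebra on point configurations in `X`, generated by the maps counting the points
in measurable sets. -/
@[reducible] noncomputable def configurationSigmaAlgebra (X : Type*) [MeasurableSpace X] : MeasurableSpace (Set X) :=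
  ⨆ (B : Set X) (_ : MeasurableSet B),
    MeasurableSpace.comap (fun S : Set X => (S ∩ B).encard) inferInstance

open Classical in
/-- The points of a set `S` of `k` real numbers, listed in increasing order
(junk value `0` if `S` does not have exactly `k` elements). -/
noncomputable def increasingPoints (S : Set ℝ) (k : ℕ) : Fin k → ℝ :=
  if h : ∃ x : Fin k → ℝ, StrictMono x ∧ Set.range x = S then h.choose else 0

theorem increasingPoints_eq {S : Set ℝ} {k : ℕ} {x : Fin k → ℝ} (hx : StrictMono x)
    (hS : Set.range x = S) : increasingPoints S k = x := by
  have h : ∃ x : Fin k → ℝ, StrictMono x ∧ Set.range x = S := ⟨x, hx, hS⟩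
  rw [increasingPoints, dif_pos h]
  exact (StrictMono.range_inj h.choose_spec.1 hx).1 (h.choose_spec.2.trans hS.symm)

/-- A graph whose vertices are real numbers, given by its vertex set `verts` and an adjacency
relation on it (no loops, no multiple edges). -/
abbrev RealGraph : Type := (⊤ : SimpleGraph ℝ).Subgraph

/-- The event that `G` has exactly `k` vertices `x₀ < ⋯ < x_{k-1}` and that `xᵢ`, `xⱼ` are joined
by an edge exactly when `i`, `j` are adjacent in `Γ`. -/
def edgePattern {Ω : Type*} (G : Ω → RealGraph) (k : ℕ) (Γ : SimpleGraph (Fin k)) : Set Ω :=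
  {ω | (G ω).verts.encard = k ∧ ∀ i j : Fin k,
    (G ω).Adj (increasingPoints (G ω).verts k i) (increasingPoints (G ω).verts k j) ↔ Γ.Adj i j}

open Classical in
/-- Given the vertex set of the random graph `G`, each pair of vertices `x`, `y` is joined by an
edge with probability `g (x - y)`, independently of all other pairs. That is: conditionally on the
vertex set (the σ-algebra it generates), on the event that there are `k` vertices
`x₀ < ⋯ < x_{k-1}`, each edge pattern `Γ` has probability
`∏_{i<j, ij ∈ Γ} g (xᵢ - xⱼ) * ∏_{i<j, ij ∉ Γ} (1 - g (xᵢ - xⱼ))`. -/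
structure HasIndependentEdges {Ω : Type*} [MeasurableSpace Ω] (G : Ω → RealGraph) (g : ℝ → ℝ)
    (μ : Measure Ω) : Prop where
  measurableSet_edgePattern : ∀ (k : ℕ) (Γ : SimpleGraph (Fin k)),
    MeasurableSet (edgePattern G k Γ)
  condProb_edgePattern : ∀ (k : ℕ) (Γ : SimpleGraph (Fin k)),
    μ⟦edgePattern G k Γ | (configurationSigmaAlgebra ℝ).comap (fun ω => (G ω).verts)⟧ =ᵐ[μ]
      Set.indicator {ω | (G ω).verts.encard = k} (fun ω =>
        ∏ p : Fin k × Fin k with p.1 < p.2,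
          (if Γ.Adj p.1 p.2 then
            g (increasingPoints (G ω).verts k p.1 - increasingPoints (G ω).verts k p.2)
          else
            1 - g (increasingPoints (G ω).verts k p.1 - increasingPoints (G ω).verts k p.2)))

/-- The soft random geometric graphs `(𝒫_n, E_n)`, `n ∈ ℕ`, with connection function `g`:
`𝒫` is a homogeneous Poisson process of unit intensity on `ℝ`, the vertex set of `G n` is
`𝒫_n = 𝒫 ∩ [-n, n]`, and given `𝒫_n` the edges are drawn independently according to `g`. -/
structure IsSoftRandomGeometricGraph {Ω : Type*} [MeasurableSpace Ω] (P : Ω → Set ℝ)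
    (G : ℕ → Ω → RealGraph) (g : ℝ → ℝ) (μ : Measure Ω) : Prop where
  poisson : IsPoissonProcess P volume μ
  verts_eq : ∀ n ω, (G n ω).verts = P ω ∩ Set.Icc (-(n : ℝ)) n
  edges : ∀ n, HasIndependentEdges (G n) g μ

/-- The length of the longest edge of a graph (`0` if there is no edge). -/
noncomputable def longestEdge (G : RealGraph) : ℝ :=
  sSup {d : ℝ | ∃ x y : ℝ, G.Adj x y ∧ d = |x - y|}

/-- The function `h (x) = (x / 2) exp ((2 - x) / x)`, a bijection from `(0, 2]` to `[1, ∞)`. -/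
noncomputable def hFun (x : ℝ) : ℝ := x / 2 * Real.exp ((2 - x) / x)

/-- `c_r = h⁻¹ (r^{-1/2}) ∈ (0, 2]`. -/
noncomputable def cConst (r : ℝ) : ℝ :=
  Function.invFunOn hFun (Set.Ioc 0 2) (r ^ (-(1 / 2) : ℝ))

/-- `g_r = exp (-√(-8 ln r))`. -/
noncomputable def gConst (r : ℝ) : ℝ := Real.exp (-√(-8 * Real.log r))

/-- The thresholds `r_n`. -/
noncomputable def threshold (α r : ℝ) (n : ℕ) : ℝ :=
  if 2 < α then
    (2 * n : ℝ) ^ (1 / (α - 1)) * ((1 - α) / 2 * Real.log r) ^ (1 / (1 - α))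
  else if α = 2 then
    cConst r * n
  else if 1 < α then
    ((2 * n : ℝ) ^ (2 - α) -
      (2 - α) * 2 ^ (1 - α / 2) * √(-Real.log r) * (n : ℝ) ^ (1 - α / 2)) ^ (1 / (2 - α))
  else if α = 1 then
    2 * n * gConst r ^ (1 / (4 * √(n : ℝ)))
  else
    ((2 * n : ℝ) ^ (1 - α) -
      (1 - α) * 2 ^ (-(α / 2)) * √(-Real.log r) * (n : ℝ) ^ (-(α / 2))) ^ (1 / (1 - α))

/-! Given the vertices, no edge is longer than `ρ` with probability `∏ (1 - g (x - y))` over the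
pairs at distance more than `ρ`. At `ρ = r_n → ∞` the values of `g` involved are small, so the
product is close to `exp (-∑ |x - y| ^ (-α))` over those pairs. The mean of this sum is about `∑_{ρ
< d ≤ 2n} (2n - d) d ^ (-α)`, and `r_n` is the threshold for which it tends to `-(log r) / 2`. If
the sum concentrates around its mean, the probability tends to `exp (log r / 2) = r ^ (1/2)`.

For the concentration, the line is cut into unit cells. A cell difference `d` fixes the distance up
to an error less than 1, so the product lies between exponentials of quadratic forms `∑ w (b - a)
N_a N_b` in independent Poisson counts of mean 1. Covariances vanish for pairs of cells without a
common cell, which gives variance at most `12 * mean * ∑ w d`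
(`IsUnitPoissonLike.integral_pairSum_sub_sq_le`). As `∑ w d → 0`, the form converges in L² and its
Laplace transform follows (`tendsto_integral_exp_neg_pairSum`).

The rest is deterministic (`threshold_asymptotics`). For `α ≥ 2` the sums are compared with
integrals. For `α < 2` the gap `2n - r_n` is asymptotic to `√(-log r) (2n) ^ (α/2) = o(n)`; then `d
^ (-α)` is essentially `(2n) ^ (-α)` on the whole range, and the sum is about `(2n - r_n)² (2n) ^
(-α) / 2`. The three formulas for `α < 2` differ, but only their common first order expansion
matters. Bounded shifts of the threshold do not change the limits, which absorbs the cell errors.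
The factor `1 ± ε` in the tail of `g` is removed at the end by `ε → 0`. -/

/-! ### Ordered points of a finite configuration and their measurability. -/

theorem increasingPoints_spec {S : Set ℝ} {k : ℕ} (h : S.encard = k) :
    StrictMono (increasingPoints S k) ∧ Set.range (increasingPoints S k) = S := by
  have hf : S.Finite := Set.finite_of_encard_eq_coe h
  have hc : hf.toFinset.card = k := by
    have := hf.encard_eq_coe_toFinset_card
    rw [h] at this
    exact_mod_cast this.symm
  have hx : StrictMono (hf.toFinset.orderEmbOfFin hc) := OrderEmbedding.strictMono _
  have hr : Set.range (hf.toFinset.orderEmbOfFin hc) = S := by simp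
  rw [increasingPoints_eq hx hr]
  exact ⟨hx, hr⟩

theorem increasingPoints_of_encard_ne {S : Set ℝ} {k : ℕ} (h : S.encard ≠ k) :
    increasingPoints S k = 0 := by
  rw [increasingPoints, dif_neg]
  rintro ⟨x, hx, rfl⟩
  apply h
  rw [← Set.image_univ, hx.injective.encard_image]
  simp

/-- Points in a set `B`, counted through the list of increasing points. -/
theorem encard_inter_eq_card_increasingPoints {S : Set ℝ} {k : ℕ} (h : S.encard = k) (B : Set ℝ)
    [DecidablePred (fun i => increasingPoints S k i ∈ B)] :
    (S ∩ B).encard = (Finset.univ.filter fun i => increasingPoints S k i ∈ B).card := by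
  obtain ⟨hx, hr⟩ := increasingPoints_spec h
  rw [← Set.encard_coe_eq_coe_finsetCard, ← hx.injective.encard_image]
  congr 1
  ext y
  constructor
  · rintro ⟨hy, hB⟩
    rw [← hr] at hy
    obtain ⟨i, rfl⟩ := hy
    exact ⟨i, by simpa using hB, rfl⟩
  · rintro ⟨i, hi, rfl⟩
    refine ⟨?_, by simpa using hi⟩
    have : increasingPoints S k i ∈ Set.range (increasingPoints S k) := ⟨i, rfl⟩
    rwa [hr] at this

theorem measurable_encard_inter {B : Set ℝ} (hB : MeasurableSet B) :
    Measurable[configurationSigmaAlgebra ℝ] (fun S : Set ℝ => (S ∩ B).encard) :=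
  measurable_iff_comap_le.2 (le_iSup₂_of_le B hB le_rfl)

theorem measurableSet_encard_eq (k : ℕ) :
    MeasurableSet[configurationSigmaAlgebra ℝ] {S : Set ℝ | S.encard = k} := by
  have := (measurable_encard_inter MeasurableSet.univ) (measurableSet_singleton (k : ℕ∞))
  simpa [Set.preimage] using this

/-- Turns order statistics into counts, the only functions measurable by definition. The inequality
is strict because indices start at 0. -/
theorem increasingPoints_lt_iff {S : Set ℝ} {k : ℕ} (h : S.encard = k) (i : Fin k) (t : ℝ) :
    increasingPoints S k i < t ↔ ((i : ℕ) : ℕ∞) < (S ∩ Set.Iio t).encard := by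
  classical
  obtain ⟨hx, -⟩ := increasingPoints_spec h
  rw [encard_inter_eq_card_increasingPoints h, Nat.cast_lt]
  constructor
  · intro hi
    have hsub : Finset.Iic i ⊆ Finset.univ.filter fun j => increasingPoints S k j ∈ Set.Iio t := by
      intro j hj
      simp only [Finset.mem_Iic] at hj
      simpa using (hx.monotone hj).trans_lt hi
    have := Finset.card_le_card hsub
    rw [Fin.card_Iic] at this
    omega
  · intro hi
    by_contra hlt
    have hsub : (Finset.univ.filter fun j => increasingPoints S k j ∈ Set.Iio t) ⊆
        Finset.Iio i := by
      intro j hj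
      simp only [Finset.mem_filter, Finset.mem_univ, true_and, Set.mem_Iio] at hj
      rw [Finset.mem_Iio]
      by_contra hij
      exact hlt ((hx.monotone (not_lt.1 hij)).trans_lt hj)
    have := Finset.card_le_card hsub
    rw [Fin.card_Iio] at this
    omega

theorem measurable_increasingPoints (k : ℕ) (i : Fin k) :
    Measurable[configurationSigmaAlgebra ℝ] (fun S : Set ℝ => increasingPoints S k i) := by
  let _ : MeasurableSpace (Set ℝ) := configurationSigmaAlgebra ℝ
  refine measurable_of_Iio fun t => ?_
  -- Off the event of `k` points the value is the default `0`, so the preimage there is everything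
  -- or nothing according to the sign of `t`.
  have hset : (fun S : Set ℝ => increasingPoints S k i) ⁻¹' Set.Iio t =
      ({S : Set ℝ | S.encard = k} ∩
        (fun S : Set ℝ => (S ∩ Set.Iio t).encard) ⁻¹' Set.Ioi ((i : ℕ) : ℕ∞)) ∪
      ({S : Set ℝ | S.encard = k}ᶜ ∩ {_S : Set ℝ | 0 < t}) := by
    ext S
    by_cases h : S.encard = k
    · simp [h, increasingPoints_lt_iff h]
    · simp [h, increasingPoints_of_encard_ne h]
  rw [hset]
  exact ((measurableSet_encard_eq k).inter
    ((measurable_encard_inter measurableSet_Iio) MeasurableSet.of_discrete)).union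
    ((measurableSet_encard_eq k).compl.inter (MeasurableSet.const _))

/-! ### The longest edge conditionally on the vertices. -/

/-- Finiteness keeps the set of lengths bounded, so its `sSup` is a true supremum; `0 ≤ ρ` covers
the edgeless graph, where `sSup ∅ = 0`. -/
theorem longestEdge_le_iff {G : RealGraph} (hG : G.verts.Finite) {ρ : ℝ} (hρ : 0 ≤ ρ) :
    longestEdge G ≤ ρ ↔ ∀ x y, G.Adj x y → |x - y| ≤ ρ := by
  have hbdd : BddAbove {d : ℝ | ∃ x y : ℝ, G.Adj x y ∧ d = |x - y|} := by
    refine ((hG.prod hG).image fun p : ℝ × ℝ => |p.1 - p.2|).subset ?_ |>.bddAbove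
    rintro d ⟨x, y, h, rfl⟩
    exact ⟨(x, y), ⟨G.edge_vert h, G.edge_vert h.symm⟩, rfl⟩
  constructor
  · intro h x y hxy
    exact (le_csSup hbdd ⟨x, y, hxy, rfl⟩).trans h
  · intro h
    refine Real.sSup_le ?_ hρ
    rintro d ⟨x, y, hxy, rfl⟩
    exact h x y hxy

theorem longestEdge_le_iff_increasingPoints {G : RealGraph} {k : ℕ} (hG : G.verts.encard = k)
    {ρ : ℝ} (hρ : 0 ≤ ρ) :
    longestEdge G ≤ ρ ↔ ∀ i j : Fin k, i < j →
      G.Adj (increasingPoints G.verts k i) (increasingPoints G.verts k j) →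
        |increasingPoints G.verts k i - increasingPoints G.verts k j| ≤ ρ := by
  rw [longestEdge_le_iff (Set.finite_of_encard_eq_coe hG) hρ]
  obtain ⟨hx, hr⟩ := increasingPoints_spec hG
  constructor
  · intro h i j _ hij
    exact h _ _ hij
  · intro h x y hxy
    have h1 := G.edge_vert hxy
    have h2 := G.edge_vert hxy.symm
    rw [← hr] at h1 h2
    obtain ⟨i, rfl⟩ := h1
    obtain ⟨j, rfl⟩ := h2
    rcases lt_trichotomy i j with hij | rfl | hij
    · exact h i j hij hxy
    · simpa using hρ
    · rw [abs_sub_comm]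
      exact h j i hij hxy.symm

/-- If the edges of a graph on `Fin k` are drawn independently with probabilities `f`, then
no pair in `L` is an edge with probability `∏ (1 - f)` over `L`. -/
theorem sum_simpleGraph_avoiding (k : ℕ) (f : Fin k × Fin k → ℝ) (L : Fin k × Fin k → Prop)
    [DecidablePred L] [∀ Γ : SimpleGraph (Fin k), DecidableRel Γ.Adj] :
    ∑ Γ : SimpleGraph (Fin k), (if ∀ i j, i < j → Γ.Adj i j → ¬ L (i, j) then
      ∏ p : Fin k × Fin k with p.1 < p.2, (if Γ.Adj p.1 p.2 then f p else 1 - f p) else 0) =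
    ∏ p : Fin k × Fin k with p.1 < p.2, (if L p then 1 - f p else 1) := by
  classical
  set Q := Finset.univ.filter fun p : Fin k × Fin k => p.1 < p.2 with hQ
  -- Each factor is the sum of its two outcomes, edge (forbidden on `L`) and non-edge.
  -- `Finset.prod_add` expands the product over subsets of `Q`, and these are exactly the graphs.
  have h1 : ∀ p ∈ Q, (if L p then 1 - f p else 1) = (if L p then 0 else f p) + (1 - f p) := by
    intro p _
    split_ifs <;> ring
  rw [Finset.prod_congr rfl h1, Finset.prod_add]
  refine Finset.sum_nbij' (fun Γ => Q.filter fun p => Γ.Adj p.1 p.2)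
    (fun t => SimpleGraph.fromRel fun i j => i < j ∧ (i, j) ∈ t) ?_ ?_ ?_ ?_ ?_
  · intro Γ _
    simp
  · intro t _
    simp
  · intro Γ _
    ext i j
    simp only [SimpleGraph.fromRel_adj, hQ, Finset.mem_filter, Finset.mem_univ, true_and]
    constructor
    · rintro ⟨_, ⟨_, _, h⟩ | ⟨_, _, h⟩⟩
      · exact h
      · exact h.symm
    · intro h
      refine ⟨h.ne, ?_⟩
      rcases lt_or_gt_of_ne h.ne with hij | hij
      · exact Or.inl ⟨hij, hij, h⟩
      · exact Or.inr ⟨hij, hij, h.symm⟩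
  · intro t ht
    rw [Finset.mem_powerset] at ht
    ext ⟨i, j⟩
    simp only [SimpleGraph.fromRel_adj, hQ, Finset.mem_filter, Finset.mem_univ, true_and]
    constructor
    · rintro ⟨hij, _, ⟨_, h⟩ | ⟨h, _⟩⟩
      · exact h
      · exact absurd h hij.asymm
    · intro h
      have hij : i < j := by simpa [hQ] using ht h
      exact ⟨hij, hij.ne, Or.inl ⟨hij, h⟩⟩
  · intro Γ _
    have h2 : Q \ Q.filter (fun p => Γ.Adj p.1 p.2) = Q.filter fun p => ¬ Γ.Adj p.1 p.2 :=
      (Finset.filter_not _ _).symm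
    rw [h2, Finset.prod_ite]
    split_ifs with hL
    · congr 1
      refine Finset.prod_congr rfl fun p hp => ?_
      simp only [hQ, Finset.mem_filter, Finset.mem_univ, true_and] at hp
      rw [if_neg (hL p.1 p.2 hp.1 hp.2)]
    · push Not at hL
      obtain ⟨i, j, hij, hΓ, hl⟩ := hL
      symm
      apply mul_eq_zero_of_left
      exact Finset.prod_eq_zero (i := (i, j)) (by simp [hQ, hij, hΓ]) (if_pos hl)

theorem IsSoftRandomGeometricGraph.measurable_verts {Ω : Type*} [MeasurableSpace Ω]
    {μ : Measure Ω} {P : Ω → Set ℝ} {G : ℕ → Ω → RealGraph} {g : ℝ → ℝ}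
    (hG : IsSoftRandomGeometricGraph P G g μ) (n : ℕ) :
    (configurationSigmaAlgebra ℝ).comap (fun ω => (G n ω).verts) ≤ ‹MeasurableSpace Ω› := by
  rw [configurationSigmaAlgebra, MeasurableSpace.comap_iSup]
  refine iSup_le fun B => ?_
  rw [MeasurableSpace.comap_iSup]
  refine iSup_le fun hB => ?_
  rw [MeasurableSpace.comap_comp, ← measurable_iff_comap_le]
  have := hG.poisson.measurable_count (Set.Icc (-(n : ℝ)) n ∩ B) (measurableSet_Icc.inter hB)
    ((measure_mono Set.inter_subset_left).trans_lt (by simp))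
  simpa [Function.comp_def, hG.verts_eq, Set.inter_assoc] using this

section

variable {Ω : Type*} [mΩ : MeasurableSpace Ω] {μ : Measure Ω} [IsProbabilityMeasure μ]
  {G : Ω → RealGraph} {g : ℝ → ℝ}

omit mΩ in
/-- On the event of having `k` vertices, the absence of edges longer than `ρ` is a disjoint union
over edge patterns. -/
theorem longestEdge_inter_eq_iUnion {ρ : ℝ} (hρ : 0 ≤ ρ) (k : ℕ) :
    {ω | longestEdge (G ω) ≤ ρ} ∩ {ω | (G ω).verts.encard = k} =
      ⋃ Γ : SimpleGraph (Fin k), (edgePattern G k Γ ∩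
        {ω | (G ω).verts.encard = k ∧ ∀ i j : Fin k, i < j → Γ.Adj i j →
          ¬ ρ < |increasingPoints (G ω).verts k i - increasingPoints (G ω).verts k j|}) := by
  ext ω
  simp only [Set.mem_inter_iff, Set.mem_ofPred_eq, Set.mem_iUnion, edgePattern, not_lt]
  constructor
  · rintro ⟨h, hk⟩
    rw [longestEdge_le_iff_increasingPoints hk hρ] at h
    refine ⟨⟨fun i j => (G ω).Adj (increasingPoints (G ω).verts k i)
      (increasingPoints (G ω).verts k j), ⟨fun i j h => h.symm⟩, ⟨fun i h => ?_⟩⟩,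
      ⟨hk, fun i j => Iff.rfl⟩, hk, h⟩
    exact h.ne rfl
  · rintro ⟨Γ, ⟨hk, hΓ⟩, -, h⟩
    refine ⟨?_, hk⟩
    rw [longestEdge_le_iff_increasingPoints hk hρ]
    exact fun i j hij ha => h i j hij ((hΓ i j).1 ha)

omit mΩ in
theorem edgePattern_disjoint (k : ℕ) :
    Pairwise (Function.onFun Disjoint (edgePattern G k)) := by
  intro Γ Γ' hne
  rw [Function.onFun, Set.disjoint_left]
  rintro ω ⟨-, h⟩ ⟨-, h'⟩
  apply hne
  ext i j
  rw [← h, ← h']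

theorem measurableSet_long_pairs_avoid (ρ : ℝ) {k : ℕ} (Γ : SimpleGraph (Fin k)) :
    MeasurableSet[configurationSigmaAlgebra ℝ] {S : Set ℝ | S.encard = k ∧
      ∀ i j : Fin k, i < j → Γ.Adj i j →
        ¬ ρ < |increasingPoints S k i - increasingPoints S k j|} := by
  let _ : MeasurableSpace (Set ℝ) := configurationSigmaAlgebra ℝ
  refine MeasurableSet.inter (measurableSet_encard_eq k) ?_
  have hset : {S : Set ℝ | ∀ i j : Fin k, i < j → Γ.Adj i j →
      ¬ ρ < |increasingPoints S k i - increasingPoints S k j|} =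
      ⋂ (i : Fin k) (j : Fin k) (_ : i < j) (_ : Γ.Adj i j),
        {S : Set ℝ | |increasingPoints S k i - increasingPoints S k j| ≤ ρ} := by
    ext S
    simp
  change MeasurableSet {S : Set ℝ | ∀ i j : Fin k, i < j → Γ.Adj i j →
      ¬ ρ < |increasingPoints S k i - increasingPoints S k j|}
  rw [hset]
  refine MeasurableSet.iInter fun i => MeasurableSet.iInter fun j =>
    MeasurableSet.iInter fun _ => MeasurableSet.iInter fun _ => ?_
  have hx := (measurable_increasingPoints k i).sub (measurable_increasingPoints k j)
  exact measurableSet_le (by simpa using hx.abs) measurable_const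

open Classical in
/-- Probability of having `k` vertices and no edge longer than `ρ`. -/
theorem HasIndependentEdges.measureReal_longestEdge_le_inter (hE : HasIndependentEdges G g μ)
    (hm : (configurationSigmaAlgebra ℝ).comap (fun ω => (G ω).verts) ≤ mΩ)
    (hg_meas : Measurable g) (hg_range : ∀ x, g x ∈ Set.Icc (0 : ℝ) 1)
    {ρ : ℝ} (hρ : 0 ≤ ρ) (k : ℕ) :
    μ.real ({ω | longestEdge (G ω) ≤ ρ} ∩ {ω | (G ω).verts.encard = k}) =
      ∫ ω in {ω | (G ω).verts.encard = k}, ∏ p : Fin k × Fin k with p.1 < p.2,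
        (if ρ < |increasingPoints (G ω).verts k p.1 - increasingPoints (G ω).verts k p.2| then
          1 - g (increasingPoints (G ω).verts k p.1 - increasingPoints (G ω).verts k p.2)
        else 1) ∂μ := by
  have hverts := comap_measurable (m := configurationSigmaAlgebra ℝ) (fun ω => (G ω).verts)
  have hA : MeasurableSet[(configurationSigmaAlgebra ℝ).comap fun ω => (G ω).verts]
      {ω | (G ω).verts.encard = k} := hverts (measurableSet_encard_eq k)
  set B : SimpleGraph (Fin k) → Set Ω := fun Γ =>
    {ω | (G ω).verts.encard = k ∧ ∀ i j : Fin k, i < j → Γ.Adj i j →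
      ¬ ρ < |increasingPoints (G ω).verts k i - increasingPoints (G ω).verts k j|} with hBdef
  have hB : ∀ Γ, MeasurableSet[(configurationSigmaAlgebra ℝ).comap fun ω => (G ω).verts] (B Γ) :=
    fun Γ => hverts (measurableSet_long_pairs_avoid ρ Γ)
  have hx : ∀ i : Fin k, Measurable fun ω => increasingPoints (G ω).verts k i := fun i =>
    ((measurable_increasingPoints k i).comp hverts).mono hm le_rfl
  set q : SimpleGraph (Fin k) → Ω → ℝ := fun Γ ω => ∏ p : Fin k × Fin k with p.1 < p.2,
    (if Γ.Adj p.1 p.2 then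
      g (increasingPoints (G ω).verts k p.1 - increasingPoints (G ω).verts k p.2)
    else 1 - g (increasingPoints (G ω).verts k p.1 - increasingPoints (G ω).verts k p.2)) with hq
  have hqm : ∀ Γ, Measurable (q Γ) := by
    intro Γ
    refine Finset.measurable_fun_prod _ fun p _ => ?_
    have : Measurable fun ω => g (increasingPoints (G ω).verts k p.1 -
        increasingPoints (G ω).verts k p.2) :=
      hg_meas.comp ((hx p.1).sub (hx p.2))
    split_ifs
    · exact this
    · exact measurable_const.sub this
  have hqi : ∀ Γ, Integrable (q Γ) μ := by
    intro Γ
    refine Integrable.of_bound (hqm Γ).aestronglyMeasurable 1 (Eventually.of_forall fun ω => ?_)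
    rw [Real.norm_eq_abs, hq, Finset.abs_prod]
    refine Finset.prod_le_one (fun _ _ => abs_nonneg _) fun p _ => ?_
    obtain ⟨h0, h1⟩ := hg_range (increasingPoints (G ω).verts k p.1 -
        increasingPoints (G ω).verts k p.2)
    split_ifs
    · rwa [abs_of_nonneg h0]
    · rw [abs_of_nonneg (by linarith)]
      linarith
  have hmeasE : ∀ Γ, MeasurableSet (edgePattern G k Γ ∩ B Γ) := fun Γ =>
    (hE.measurableSet_edgePattern k Γ).inter (hm _ (hB Γ))
  -- `B Γ` depends on the vertices only, so integrating the conditional probability of the pattern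
  -- over it gives the probability of the intersection.
  have hΓ : ∀ Γ, μ.real (edgePattern G k Γ ∩ B Γ) = ∫ ω in {ω | (G ω).verts.encard = k},
      (B Γ).indicator (q Γ) ω ∂μ := by
    intro Γ
    have h1 := setIntegral_condExp (μ := μ) hm
      (f := (edgePattern G k Γ).indicator fun _ => (1 : ℝ))
      ((integrable_const 1).indicator (hE.measurableSet_edgePattern k Γ)) (hB Γ)
    rw [setIntegral_indicator (hE.measurableSet_edgePattern k Γ), setIntegral_const,
      smul_eq_mul, mul_one, Set.inter_comm] at h1
    rw [← h1, setIntegral_congr_ae (hm _ (hB Γ))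
      ((hE.condProb_edgePattern k Γ).mono fun ω h _ => h),
      setIntegral_indicator (hm _ hA), setIntegral_indicator (hm _ (hB Γ)), Set.inter_comm]
  rw [longestEdge_inter_eq_iUnion hρ k, measureReal_def, measure_iUnion, tsum_fintype]
  · rw [ENNReal.toReal_sum (fun _ _ => measure_ne_top _ _)]
    refine (Finset.sum_congr rfl fun Γ _ => hΓ Γ).trans ?_
    rw [← integral_finsetSum]
    · refine setIntegral_congr_fun (hm _ hA) fun ω hω => ?_
      have hω : (G ω).verts.encard = k := hω
      rw [← sum_simpleGraph_avoiding k (fun p => g (increasingPoints (G ω).verts k p.1 -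
        increasingPoints (G ω).verts k p.2)) (fun p =>
        ρ < |increasingPoints (G ω).verts k p.1 - increasingPoints (G ω).verts k p.2|)]
      refine Finset.sum_congr rfl fun Γ _ => ?_
      simp only [Set.indicator, hBdef, Set.mem_ofPred_eq, hω, true_and, hq]
    · exact fun Γ _ => ((hqi Γ).indicator (hm _ (hB Γ))).integrableOn
  · exact fun Γ Γ' h => (edgePattern_disjoint k h).mono Set.inter_subset_left Set.inter_subset_left
  · exact hmeasE

end

/-! ### Discretisation: from products over pairs of points to a quadratic form in cell counts. -/

/-- The quadratic form `∑_{a < b < M} w (b - a) N_a N_b`. -/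
def pairSum (M : ℕ) (w N : ℕ → ℝ) : ℝ :=
  ∑ p ∈ Finset.range M ×ˢ Finset.range M with p.1 < p.2, w (p.2 - p.1) * (N p.1 * N p.2)

theorem pairSum_nonneg {M : ℕ} {w N : ℕ → ℝ} (hw : ∀ d, 0 ≤ w d) (hN : ∀ a, 0 ≤ N a) :
    0 ≤ pairSum M w N :=
  Finset.sum_nonneg fun _ _ => mul_nonneg (hw _) (mul_nonneg (hN _) (hN _))

theorem pairSum_mono {M : ℕ} {w N N' : ℕ → ℝ} (hw : ∀ d, 0 ≤ w d) (hN : ∀ a, 0 ≤ N a)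
    (h : ∀ a < M, N a ≤ N' a) : pairSum M w N ≤ pairSum M w N' := by
  refine Finset.sum_le_sum fun p hp => ?_
  simp only [Finset.mem_filter, Finset.mem_product, Finset.mem_range] at hp
  exact mul_le_mul_of_nonneg_left (mul_le_mul (h _ hp.1.1) (h _ hp.1.2) (hN _)
    ((hN _).trans (h _ hp.1.1))) (hw _)

theorem pairSum_congr {M : ℕ} {w N N' : ℕ → ℝ} (h : ∀ a < M, N a = N' a) :
    pairSum M w N = pairSum M w N' := by
  refine Finset.sum_congr rfl fun p hp => ?_
  simp only [Finset.mem_filter, Finset.mem_product, Finset.mem_range] at hp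
  rw [h _ hp.1.1, h _ hp.1.2]

/-- Cell counts of `k` labelled points: the quadratic form is a sum over pairs of points. -/
theorem pairSum_card_eq {k : ℕ} (M : ℕ) (w : ℕ → ℝ) (c : Fin k → ℕ) (hc : Monotone c) :
    pairSum M w (fun a => ((Finset.univ.filter fun i => c i = a).card : ℝ)) =
      ∑ p : Fin k × Fin k with p.1 < p.2,
        if c p.1 < c p.2 ∧ c p.2 < M then w (c p.2 - c p.1) else 0 := by
  have h1 : ∀ a, ((Finset.univ.filter fun i => c i = a).card : ℝ) =
      ∑ i, if c i = a then (1 : ℝ) else 0 := by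
    intro a
    simp
  have h2 : ∀ p : ℕ × ℕ, w (p.2 - p.1) * (((Finset.univ.filter fun i => c i = p.1).card : ℝ) *
      ((Finset.univ.filter fun i => c i = p.2).card : ℝ)) =
      ∑ q : Fin k × Fin k, if (c q.1, c q.2) = p then w (p.2 - p.1) else 0 := by
    intro p
    rw [h1, h1, Finset.sum_mul_sum, ← Finset.sum_product', Finset.mul_sum]
    refine Finset.sum_congr rfl fun q _ => ?_
    by_cases h : c q.1 = p.1 <;> by_cases h' : c q.2 = p.2 <;> simp [h, h', Prod.ext_iff]
  rw [pairSum, Finset.sum_congr rfl fun p _ => h2 p, Finset.sum_comm, Finset.sum_filter]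
  refine Finset.sum_congr rfl fun q _ => ?_
  rw [Finset.sum_ite_eq]
  simp only [Finset.mem_filter, Finset.mem_product, Finset.mem_range]
  by_cases hq : q.1 < q.2
  · rw [if_pos hq]
    have : (c q.1 < M ∧ c q.2 < M) ∧ c q.1 < c q.2 ↔ c q.1 < c q.2 ∧ c q.2 < M := by omega
    simp only [this]
  · have := hc (not_lt.1 hq)
    rw [if_neg hq, if_neg (by omega)]

/-- Each floor loses less than 1. This is the whole discretisation error. -/
theorem abs_sub_floor_lt {s x y : ℝ} (hx : -s ≤ x) (hxy : x ≤ y) :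
    ((⌊y + s⌋₊ - ⌊x + s⌋₊ : ℕ) : ℝ) - 1 < |x - y| ∧
      |x - y| < ((⌊y + s⌋₊ - ⌊x + s⌋₊ : ℕ) : ℝ) + 1 := by
  have hle : ⌊x + s⌋₊ ≤ ⌊y + s⌋₊ := Nat.floor_mono (by linarith)
  rw [Nat.cast_sub hle, abs_sub_comm, abs_of_nonneg (by linarith)]
  have h1 := Nat.floor_le (show 0 ≤ x + s by linarith)
  have h2 := Nat.floor_le (show 0 ≤ y + s by linarith)
  have h3 := Nat.lt_floor_add_one (x + s)
  have h4 := Nat.lt_floor_add_one (y + s)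
  constructor <;> linarith

section

variable {k : ℕ} {x : Fin k → ℝ} {s : ℝ} {φ : ℝ → ℝ} {w : ℕ → ℝ}

/-- Pairs within one cell, or with a point beyond the first `M` cells, are absent from the form;
their factors are dropped because `φ ≤ 1`. -/
theorem prod_le_exp_neg_pairSum (hx : StrictMono x) (hs : ∀ i, -s ≤ x i) (M : ℕ)
    (h0 : ∀ t, 0 ≤ φ t) (h1 : ∀ t, φ t ≤ 1)
    (hw : ∀ (d : ℕ) (t : ℝ), (d : ℝ) - 1 < |t| → |t| < d + 1 → φ t ≤ Real.exp (-w d)) :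
    ∏ p : Fin k × Fin k with p.1 < p.2, φ (x p.1 - x p.2) ≤
      Real.exp (-pairSum M w
        (fun a => ((Finset.univ.filter fun i => ⌊x i + s⌋₊ = a).card : ℝ))) := by
  rw [pairSum_card_eq M w (fun i => ⌊x i + s⌋₊) fun i j hij =>
    Nat.floor_mono (by linarith [hx.monotone hij]), ← Finset.sum_neg_distrib, Real.exp_sum]
  refine Finset.prod_le_prod (fun _ _ => h0 _) fun p hp => ?_
  simp only [Finset.mem_filter, Finset.mem_univ, true_and] at hp
  obtain ⟨h2, h3⟩ := abs_sub_floor_lt (hs p.1) (hx hp).le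
  split_ifs with h
  · exact hw _ _ h2 h3
  · simpa using h1 _

/-- For a lower bound no pair may be lost: `hM` puts every point into the first `M` cells, and pairs
within one cell are closer than 1, where `φ = 1`. -/
theorem exp_neg_pairSum_le_prod (hx : StrictMono x) (hs : ∀ i, -s ≤ x i) (M : ℕ)
    (hM : ∀ i, x i + s < M) (h1 : ∀ t, |t| ≤ 1 → φ t = 1)
    (hw : ∀ (d : ℕ) (t : ℝ), (d : ℝ) - 1 < |t| → |t| < d + 1 → Real.exp (-w d) ≤ φ t) :
    Real.exp (-pairSum M w
        (fun a => ((Finset.univ.filter fun i => ⌊x i + s⌋₊ = a).card : ℝ))) ≤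
      ∏ p : Fin k × Fin k with p.1 < p.2, φ (x p.1 - x p.2) := by
  have hmono : Monotone fun i => ⌊x i + s⌋₊ := fun i j hij =>
    Nat.floor_mono (by linarith [hx.monotone hij])
  rw [pairSum_card_eq M w _ hmono, ← Finset.sum_neg_distrib, Real.exp_sum]
  refine Finset.prod_le_prod (fun _ _ => (Real.exp_pos _).le) fun p hp => ?_
  simp only [Finset.mem_filter, Finset.mem_univ, true_and] at hp
  obtain ⟨h2, h3⟩ := abs_sub_floor_lt (hs p.1) (hx hp).le
  split_ifs with h
  · exact hw _ _ h2 h3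
  · have hlt : ⌊x p.2 + s⌋₊ < M := (Nat.floor_lt (by linarith [hs p.2])).2 (hM p.2)
    have hle : ⌊x p.2 + s⌋₊ ≤ ⌊x p.1 + s⌋₊ := by
      by_contra hcon
      exact h ⟨not_le.1 hcon, hlt⟩
    rw [Nat.sub_eq_zero_of_le hle] at h3
    rw [h1 _ (by simpa using h3.le)]
    simp

end

/-! ### Cell counts of the process and the two-sided bound for the probability. -/

/-- The number of points of `S` in the unit cell `[a - s, a + 1 - s)`. -/
noncomputable def cellCount (S : Set ℝ) (s : ℝ) (a : ℕ) : ℝ :=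
  ((S ∩ Set.Ico (a - s) (a + 1 - s)).encard.toNat : ℝ)

theorem cellCount_eq_card {S : Set ℝ} {k : ℕ} (h : S.encard = k) {s : ℝ}
    (hs : ∀ x ∈ S, -s ≤ x) (a : ℕ) :
    cellCount S s a =
      ((Finset.univ.filter fun i => ⌊increasingPoints S k i + s⌋₊ = a).card : ℝ) := by
  classical
  obtain ⟨-, hr⟩ := increasingPoints_spec h
  rw [cellCount, encard_inter_eq_card_increasingPoints h, ENat.toNat_natCast]
  congr 2
  ext i
  have hi : -s ≤ increasingPoints S k i := hs _ (hr.subset ⟨i, rfl⟩)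
  simp only [Finset.mem_filter, Finset.mem_univ, true_and, Set.mem_Ico]
  rw [Nat.floor_eq_iff (by linarith)]
  constructor <;> rintro ⟨h1, h2⟩ <;> constructor <;> linarith

theorem hasSum_setIntegral_of_cover {Ω : Type*} [MeasurableSpace Ω] {μ : Measure Ω}
    {A : ℕ → Set Ω} (hA : ∀ k, MeasurableSet (A k))
    (hdisj : Pairwise (Function.onFun Disjoint A)) (hcov : ∀ᵐ ω ∂μ, ω ∈ ⋃ k, A k) {f : Ω → ℝ}
    (hf : Integrable f μ) : HasSum (fun k => ∫ ω in A k, f ω ∂μ) (∫ ω, f ω ∂μ) := by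
  have := hasSum_integral_iUnion hA hdisj hf.integrableOn
  rwa [setIntegral_eq_integral_of_ae_compl_eq_zero] at this
  filter_upwards [hcov] with ω h h'
  exact absurd h h'

/-- `E` itself need not be measurable: up to a null set it is the union of its measurable pieces.
This is needed since `longestEdge` is controlled only on events with a given finite number of
vertices. -/
theorem hasSum_measureReal_inter_of_cover {Ω : Type*} [MeasurableSpace Ω] {μ : Measure Ω}
    [IsFiniteMeasure μ] {A : ℕ → Set Ω} (hA : ∀ k, MeasurableSet (A k))
    (hdisj : Pairwise (Function.onFun Disjoint A)) (hcov : ∀ᵐ ω ∂μ, ω ∈ ⋃ k, A k) {E : Set Ω}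
    (hE : ∀ k, MeasurableSet (E ∩ A k)) :
    HasSum (fun k => μ.real (E ∩ A k)) (μ.real E) := by
  have hm : MeasurableSet (⋃ k, E ∩ A k) := MeasurableSet.iUnion hE
  have h := hasSum_setIntegral_of_cover hA hdisj hcov
    (f := (⋃ k, E ∩ A k).indicator fun _ => (1 : ℝ)) ((integrable_const 1).indicator hm)
  have h1 : μ.real (⋃ k, E ∩ A k) = μ.real E := by
    refine measureReal_congr ?_
    filter_upwards [hcov] with ω hω
    rw [← Set.inter_iUnion]
    exact propext ⟨fun h => h.1, fun h => ⟨h, hω⟩⟩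
  rw [integral_indicator_const _ hm, smul_eq_mul, mul_one, h1] at h
  convert h using 2 with k
  rw [setIntegral_indicator hm, setIntegral_const, smul_eq_mul, mul_one]
  congr 1
  ext ω
  simp only [Set.mem_inter_iff, Set.mem_iUnion]
  exact ⟨fun h => ⟨h.2, k, h⟩, fun ⟨h, _, h', _⟩ => ⟨h', h⟩⟩

theorem IsPoissonProcess.ae_encard_ne_top {Ω X : Type*} [MeasurableSpace Ω] [MeasurableSpace X]
    {N : Ω → Set X} {ν : Measure X} {μ : Measure Ω} (hN : IsPoissonProcess N ν μ) {B : Set X}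
    (hB : MeasurableSet B) (hν : ν B < ∞) : ∀ᵐ ω ∂μ, (N ω ∩ B).encard ≠ ⊤ := by
  have h := DFunLike.congr_fun (hN.map_count B hB hν) {⊤}
  rw [Measure.map_apply (hN.measurable_count B hB hν) (measurableSet_singleton _),
    Measure.map_apply .of_discrete (measurableSet_singleton _)] at h
  rw [ae_iff]
  have h0 : (fun k : ℕ => (k : ℕ∞)) ⁻¹' {⊤} = ∅ := by
    ext k
    simp
  rw [h0, measure_empty] at h
  simpa [Set.preimage] using h

theorem IsPoissonProcess.measurable_cellCount {Ω : Type*} [MeasurableSpace Ω]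
    {N : Ω → Set ℝ} {μ : Measure Ω} (hN : IsPoissonProcess N volume μ) (s : ℝ) (a : ℕ) :
    Measurable fun ω => cellCount (N ω) s a :=
  (Measurable.of_discrete (f := fun m : ℕ∞ => (m.toNat : ℝ))).comp
    (hN.measurable_count _ measurableSet_Ico (by simp))

theorem cellCount_nonneg (S : Set ℝ) (s : ℝ) (a : ℕ) : 0 ≤ cellCount S s a := Nat.cast_nonneg _

theorem measurable_pairSum {Ω : Type*} [MeasurableSpace Ω] {N : Ω → ℕ → ℝ}
    (hN : ∀ a, Measurable fun ω => N ω a) (M : ℕ) (w : ℕ → ℝ) :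
    Measurable fun ω => pairSum M w (N ω) :=
  Finset.measurable_fun_sum _ fun p _ => ((hN p.1).mul (hN p.2)).const_mul _

theorem integrable_exp_neg_of_nonneg {Ω : Type*} [MeasurableSpace Ω] {μ : Measure Ω}
    [IsFiniteMeasure μ] {f : Ω → ℝ} (hf : Measurable f) (h0 : ∀ ω, 0 ≤ f ω) :
    Integrable (fun ω => Real.exp (-f ω)) μ := by
  refine Integrable.of_bound (Real.measurable_exp.comp hf.neg).aestronglyMeasurable 1
    (Eventually.of_forall fun ω => ?_)
  rw [Real.norm_eq_abs, Real.abs_exp, Real.exp_le_one_iff]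
  linarith [h0 ω]

section

variable {Ω : Type*} [mΩ : MeasurableSpace Ω] {μ : Measure Ω} [IsProbabilityMeasure μ]
  {g : ℝ → ℝ} {P : Ω → Set ℝ} {G : ℕ → Ω → RealGraph}

omit [IsProbabilityMeasure μ] in
theorem IsSoftRandomGeometricGraph.ae_mem_iUnion_encard (hG : IsSoftRandomGeometricGraph P G g μ)
    (n : ℕ) : ∀ᵐ ω ∂μ, ω ∈ ⋃ k : ℕ, {ω | (G n ω).verts.encard = k} := by
  filter_upwards [hG.poisson.ae_encard_ne_top (B := Set.Icc (-(n : ℝ)) n) measurableSet_Icc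
    (by simp)] with ω hω
  rw [← hG.verts_eq] at hω
  obtain ⟨k, hk⟩ := ENat.ne_top_iff_exists.1 hω
  exact Set.mem_iUnion.2 ⟨k, hk.symm⟩

omit [IsProbabilityMeasure μ] in
theorem IsSoftRandomGeometricGraph.measurableSet_encard (hG : IsSoftRandomGeometricGraph P G g μ)
    (n k : ℕ) : MeasurableSet {ω | (G n ω).verts.encard = k} :=
  hG.measurable_verts n _ ⟨_, measurableSet_encard_eq k, rfl⟩

omit [IsProbabilityMeasure μ] in
theorem IsSoftRandomGeometricGraph.measurableSet_longestEdge_inter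
    (hG : IsSoftRandomGeometricGraph P G g μ) {ρ : ℝ} (hρ : 0 ≤ ρ) (n k : ℕ) :
    MeasurableSet ({ω | longestEdge (G n ω) ≤ ρ} ∩ {ω | (G n ω).verts.encard = k}) := by
  rw [longestEdge_inter_eq_iUnion hρ k]
  exact MeasurableSet.iUnion fun Γ => ((hG.edges n).measurableSet_edgePattern k Γ).inter
    (hG.measurable_verts n _ ⟨_, measurableSet_long_pairs_avoid ρ Γ, rfl⟩)

omit mΩ in
theorem pairwise_disjoint_encard (n : ℕ) :
    Pairwise (Function.onFun Disjoint fun k : ℕ => {ω | (G n ω).verts.encard = k}) := by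
  intro k l hkl
  rw [Function.onFun, Set.disjoint_left]
  intro ω (h : _ = _) (h' : _ = _)
  rw [h] at h'
  exact hkl (by exact_mod_cast h')

omit [IsProbabilityMeasure μ] in
open Classical in
theorem measurable_prod_long_pairs (hG : IsSoftRandomGeometricGraph P G g μ)
    (hg_meas : Measurable g) (n k : ℕ) (ρ : ℝ) :
    Measurable fun ω => ∏ p : Fin k × Fin k with p.1 < p.2,
      (if ρ < |increasingPoints (G n ω).verts k p.1 - increasingPoints (G n ω).verts k p.2| then
        1 - g (increasingPoints (G n ω).verts k p.1 - increasingPoints (G n ω).verts k p.2)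
      else 1) := by
  refine Finset.measurable_fun_prod _ fun p _ => ?_
  have hx : ∀ i : Fin k, Measurable fun ω => increasingPoints (G n ω).verts k i := fun i =>
    ((measurable_increasingPoints k i).comp
      (comap_measurable (m := configurationSigmaAlgebra ℝ) (fun ω => (G n ω).verts))).mono
      (hG.measurable_verts n) le_rfl
  have hd : Measurable fun ω => increasingPoints (G n ω).verts k p.1 -
    increasingPoints (G n ω).verts k p.2 := (hx p.1).sub (hx p.2)
  exact Measurable.ite (measurableSet_lt measurable_const (by simpa using hd.abs))
    (measurable_const.sub (hg_meas.comp hd)) measurable_const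

open Classical in
/-- Upper bound through the counts in the `2 n` unit cells of `[-n, n)`. -/
theorem IsSoftRandomGeometricGraph.measureReal_longestEdge_le_le
    (hG : IsSoftRandomGeometricGraph P G g μ)
    (hg_meas : Measurable g) (hg_range : ∀ x, g x ∈ Set.Icc (0 : ℝ) 1) (n : ℕ)
    {ρ : ℝ} (hρ : 0 ≤ ρ) {w : ℕ → ℝ} (hw0 : ∀ d, 0 ≤ w d)
    (hw : ∀ (d : ℕ) (t : ℝ), (d : ℝ) - 1 < |t| → |t| < d + 1 →
      (if ρ < |t| then 1 - g t else 1) ≤ Real.exp (-w d)) :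
    μ.real {ω | longestEdge (G n ω) ≤ ρ} ≤
      ∫ ω, Real.exp (-pairSum (2 * n) w (cellCount (P ω) n)) ∂μ := by
  have hint : Integrable (fun ω => Real.exp (-pairSum (2 * n) w (cellCount (P ω) n))) μ :=
    integrable_exp_neg_of_nonneg
      (measurable_pairSum (fun a => hG.poisson.measurable_cellCount n a) _ _)
      fun ω => pairSum_nonneg hw0 (cellCount_nonneg _ _)
  have hA := hG.measurableSet_encard n
  refine hasSum_le (fun k => ?_) (hasSum_measureReal_inter_of_cover hA
    (pairwise_disjoint_encard n) (hG.ae_mem_iUnion_encard n)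
    (hG.measurableSet_longestEdge_inter hρ n)) (hasSum_setIntegral_of_cover hA
    (pairwise_disjoint_encard n) (hG.ae_mem_iUnion_encard n) hint)
  rw [(hG.edges n).measureReal_longestEdge_le_inter (hG.measurable_verts n) hg_meas hg_range hρ]
  have key : ∀ ω, (G n ω).verts.encard = k → ∏ p : Fin k × Fin k with p.1 < p.2,
      (if ρ < |increasingPoints (G n ω).verts k p.1 - increasingPoints (G n ω).verts k p.2| then
        1 - g (increasingPoints (G n ω).verts k p.1 - increasingPoints (G n ω).verts k p.2)
      else 1) ≤ Real.exp (-pairSum (2 * n) w (cellCount (P ω) n)) := by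
    intro ω hω
    obtain ⟨hx, hr⟩ := increasingPoints_spec hω
    have hs : ∀ y ∈ (G n ω).verts, -(n : ℝ) ≤ y := by
      intro y hy
      rw [hG.verts_eq] at hy
      exact hy.2.1
    -- The first `2 * n` cells fill `[-n, n)`, so restricting the process to `[-n, n]` does not
    -- change their counts.
    have hcell : ∀ a < 2 * n, cellCount (P ω) n a = ((Finset.univ.filter fun i =>
        ⌊increasingPoints (G n ω).verts k i + n⌋₊ = a).card : ℝ) := by
      intro a ha
      rw [← cellCount_eq_card hω hs, cellCount, cellCount, hG.verts_eq, Set.inter_assoc]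
      congr 4
      rw [eq_comm, Set.inter_eq_right]
      rintro y ⟨hy1, hy2⟩
      have : (a : ℝ) + 1 ≤ 2 * n := by exact_mod_cast ha
      have : (0 : ℝ) ≤ a := a.cast_nonneg
      constructor <;> linarith
    rw [pairSum_congr hcell]
    refine prod_le_exp_neg_pairSum (φ := fun t => if ρ < |t| then 1 - g t else 1) hx
      (fun i => hs _ (hr.subset ⟨i, rfl⟩)) _ (fun t => ?_) (fun t => ?_) hw
    · split_ifs
      · linarith [(hg_range t).2]
      · exact zero_le_one
    · split_ifs
      · linarith [(hg_range t).1]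
      · exact le_rfl
  refine setIntegral_mono_on ?_ hint.integrableOn (hA k) key
  refine Integrable.mono' hint.integrableOn
    (measurable_prod_long_pairs hG hg_meas n k ρ).aestronglyMeasurable ?_
  filter_upwards [ae_restrict_mem (hA k)] with ω hω
  rw [Real.norm_eq_abs, abs_of_nonneg]
  · exact key ω hω
  · refine Finset.prod_nonneg fun p _ => ?_
    split_ifs
    · linarith [(hg_range (increasingPoints (G n ω).verts k p.1 -
        increasingPoints (G n ω).verts k p.2)).2]
    · exact zero_le_one

open Classical in
/-- Lower bound through the counts in the `2 n + 1` unit cells of `[-n, n + 1)`. -/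
theorem IsSoftRandomGeometricGraph.le_measureReal_longestEdge_le
    (hG : IsSoftRandomGeometricGraph P G g μ)
    (hg_meas : Measurable g) (hg_range : ∀ x, g x ∈ Set.Icc (0 : ℝ) 1) (n : ℕ)
    {ρ : ℝ} (hρ : 1 ≤ ρ) {w : ℕ → ℝ} (hw0 : ∀ d, 0 ≤ w d)
    (hw : ∀ (d : ℕ) (t : ℝ), (d : ℝ) - 1 < |t| → |t| < d + 1 →
      Real.exp (-w d) ≤ if ρ < |t| then 1 - g t else 1) :
    ∫ ω, Real.exp (-pairSum (2 * n + 1) w (cellCount (P ω) n)) ∂μ ≤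
      μ.real {ω | longestEdge (G n ω) ≤ ρ} := by
  have hρ0 : 0 ≤ ρ := by linarith
  have hint : Integrable (fun ω => Real.exp (-pairSum (2 * n + 1) w (cellCount (P ω) n))) μ :=
    integrable_exp_neg_of_nonneg
      (measurable_pairSum (fun a => hG.poisson.measurable_cellCount n a) _ _)
      fun ω => pairSum_nonneg hw0 (cellCount_nonneg _ _)
  have hA := hG.measurableSet_encard n
  refine hasSum_le (fun k => ?_) (hasSum_setIntegral_of_cover hA
    (pairwise_disjoint_encard n) (hG.ae_mem_iUnion_encard n) hint)
    (hasSum_measureReal_inter_of_cover hA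
    (pairwise_disjoint_encard n) (hG.ae_mem_iUnion_encard n)
    (hG.measurableSet_longestEdge_inter hρ0 n))
  rw [(hG.edges n).measureReal_longestEdge_le_inter (hG.measurable_verts n) hg_meas hg_range hρ0]
  refine setIntegral_mono_on_ae hint.integrableOn ?_ (hA k) ?_
  · refine Integrable.of_bound
      (measurable_prod_long_pairs hG hg_meas n k ρ).aestronglyMeasurable 1
      (Eventually.of_forall fun ω => ?_)
    rw [Real.norm_eq_abs, Finset.abs_prod]
    refine Finset.prod_le_one (fun _ _ => abs_nonneg _) fun p _ => ?_
    obtain ⟨h0, h1⟩ := hg_range (increasingPoints (G n ω).verts k p.1 -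
        increasingPoints (G n ω).verts k p.2)
    split_ifs
    · rw [abs_of_nonneg (by linarith)]
      linarith
    · simp
  · have hfin : ∀ᵐ ω ∂μ, ∀ a : ℕ, (P ω ∩ Set.Ico ((a : ℝ) - n) (a + 1 - n)).encard ≠ ⊤ :=
      ae_all_iff.2 fun a => hG.poisson.ae_encard_ne_top measurableSet_Ico (by simp)
    filter_upwards [hfin] with ω hf hω
    have hω : (G n ω).verts.encard = k := hω
    obtain ⟨hx, hr⟩ := increasingPoints_spec hω
    have hs : ∀ y ∈ (G n ω).verts, -(n : ℝ) ≤ y ∧ y ≤ n := by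
      intro y hy
      rw [hG.verts_eq] at hy
      exact hy.2
    refine (Real.exp_le_exp.2 (neg_le_neg ?_)).trans
      (exp_neg_pairSum_le_prod (φ := fun t => if ρ < |t| then 1 - g t else 1) hx
      (fun i => (hs _ (hr.subset ⟨i, rfl⟩)).1) (2 * n + 1) (fun i => ?_) (fun t ht => ?_) hw)
    -- The cell of index `2 * n` is needed for a point at `n` but reaches to `n + 1`; counting all
    -- of the process there only enlarges the form.
    · refine pairSum_mono hw0 (fun _ => Nat.cast_nonneg _) fun a _ => ?_
      rw [← cellCount_eq_card hω fun y hy => (hs y hy).1, cellCount, cellCount, Nat.cast_le]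
      refine ENat.toNat_le_toNat (Set.encard_le_encard ?_) (hf a)
      rw [hG.verts_eq]
      exact Set.inter_subset_inter_left _ Set.inter_subset_left
    · have := (hs _ (hr.subset ⟨i, rfl⟩)).2
      push_cast
      linarith
    · exact if_neg (by linarith)

end

/-! ### Moments and independence of the cell counts. -/

theorem hasSum_mul_poissonMeasure_one :
    HasSum (fun n : ℕ => Real.exp (-1) * 1 ^ n / (n.factorial : ℝ) * n) 1 := by
  have h := hasSum_one_poissonMeasure 1
  rw [← hasSum_nat_add_iff' 1]
  simp only [NNReal.coe_one] at h
  simp only [Finset.range_one, Finset.sum_singleton, Nat.cast_zero, mul_zero, sub_zero]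
  refine h.congr_fun fun n => ?_
  rw [Nat.factorial_succ]
  have h1 : (n.factorial : ℝ) ≠ 0 := by positivity
  have h2 : (n : ℝ) + 1 ≠ 0 := by positivity
  push_cast
  field_simp
  ring

theorem hasSum_sq_mul_poissonMeasure_one :
    HasSum (fun n : ℕ => Real.exp (-1) * 1 ^ n / (n.factorial : ℝ) * (n : ℝ) ^ 2) 2 := by
  have h := hasSum_one_poissonMeasure 1
  have h' := hasSum_mul_poissonMeasure_one
  rw [← hasSum_nat_add_iff' 1]
  simp only [NNReal.coe_one] at h
  simp only [Finset.range_one, Finset.sum_singleton, Nat.cast_zero, ne_eq, OfNat.ofNat_ne_zero,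
    not_false_eq_true, zero_pow, mul_zero, sub_zero]
  rw [show (2 : ℝ) = 1 + 1 by norm_num]
  refine (h.add h').congr_fun fun n => ?_
  rw [Nat.factorial_succ]
  have h1 : (n.factorial : ℝ) ≠ 0 := by positivity
  have h2 : (n : ℝ) + 1 ≠ 0 := by positivity
  push_cast
  field_simp
  ring

/-- Square integrable random variables, independent, with first moment `1` and second
moment `2`, as for the Poisson distribution with mean `1`. -/
structure IsUnitPoissonLike {Ω : Type*} [MeasurableSpace Ω] (X : ℕ → Ω → ℝ) (μ : Measure Ω) :
    Prop where
  meas : ∀ a, Measurable (X a)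
  nonneg : ∀ a ω, 0 ≤ X a ω
  indep : ∀ M : ℕ, iIndepFun (fun i : Fin M => X i) μ
  integrable : ∀ a, Integrable (X a) μ
  integrable_sq : ∀ a, Integrable (fun ω => X a ω ^ 2) μ
  integral : ∀ a, ∫ ω, X a ω ∂μ = 1
  integral_sq : ∀ a, ∫ ω, X a ω ^ 2 ∂μ = 2

theorem IsPoissonProcess.isUnitPoissonLike_cellCount {Ω : Type*} [MeasurableSpace Ω]
    {N : Ω → Set ℝ} {μ : Measure Ω} (hN : IsPoissonProcess N volume μ) (s : ℝ) :
    IsUnitPoissonLike (fun a ω => cellCount (N ω) s a) μ := by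
  have hvol : ∀ a : ℕ, volume (Set.Ico (a - s) (a + 1 - s)) = 1 := by
    intro a
    rw [Real.volume_Ico]
    norm_num
  have hmeas : ∀ a : ℕ, Measurable fun ω => (N ω ∩ Set.Ico (a - s) (a + 1 - s)).encard :=
    fun a => hN.measurable_count _ measurableSet_Ico (by simp)
  have hlaw : ∀ a : ℕ, μ.map (fun ω => (N ω ∩ Set.Ico (a - s) (a + 1 - s)).encard) =
      (poissonMeasure 1).map (fun k : ℕ => (k : ℕ∞)) := by
    intro a
    rw [hN.map_count _ measurableSet_Ico (by simp), hvol]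
    simp
  have hint : ∀ (a : ℕ) (f : ℝ → ℝ), ∫ ω, f (cellCount (N ω) s a) ∂μ =
      ∫ k : ℕ, f k ∂(poissonMeasure 1) := by
    intro a f
    have h := integral_map (μ := μ) (hmeas a).aemeasurable
      (f := fun m : ℕ∞ => f (m.toNat : ℝ)) .of_discrete
    rw [hlaw, integral_map .of_discrete .of_discrete] at h
    simpa [cellCount] using h.symm
  have hintegrable : ∀ (a : ℕ) (f : ℝ → ℝ), Integrable (fun k : ℕ => f k) (poissonMeasure 1) →
      Integrable (fun ω => f (cellCount (N ω) s a)) μ := by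
    intro a f hf
    have h := integrable_map_measure (μ := μ) (f := fun ω => (N ω ∩ Set.Ico (a - s)
      (a + 1 - s)).encard) (g := fun m : ℕ∞ => f (m.toNat : ℝ)) .of_discrete
      (hmeas a).aemeasurable
    rw [hlaw, integrable_map_measure .of_discrete .of_discrete] at h
    refine h.1 ?_
    simpa [Function.comp_def] using hf
  have hsum1 : Integrable (fun k : ℕ => (k : ℝ)) (poissonMeasure 1) := by
    rw [integrable_poissonMeasure_iff]
    simpa using hasSum_mul_poissonMeasure_one.summable
  have hsum2 : Integrable (fun k : ℕ => (k : ℝ) ^ 2) (poissonMeasure 1) := by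
    rw [integrable_poissonMeasure_iff]
    simpa using hasSum_sq_mul_poissonMeasure_one.summable
  refine ⟨fun a => hN.measurable_cellCount s a, fun a ω => cellCount_nonneg _ _ _, fun M => ?_,
    fun a => hintegrable a (fun t => t) hsum1, fun a => hintegrable a (fun t => t ^ 2) hsum2,
    fun a => ?_, fun a => ?_⟩
  · have h := hN.indep_count M (fun i => Set.Ico ((i : ℕ) - s) ((i : ℕ) + 1 - s))
      (fun _ => measurableSet_Ico) (fun _ => by simp) (fun i j hij => ?_)
    · exact h.comp (fun _ m => (m.toNat : ℝ)) fun _ => .of_discrete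
    · refine Set.disjoint_left.2 ?_
      rintro y ⟨h1, h2⟩ ⟨h3, h4⟩
      apply hij
      have h5 : ((i : ℕ) : ℝ) < (j : ℕ) + 1 := by linarith
      have h6 : ((j : ℕ) : ℝ) < (i : ℕ) + 1 := by linarith
      norm_cast at h5 h6
      ext
      omega
  · rw [hint a fun t => t, integral_poissonMeasure]
    simpa using hasSum_mul_poissonMeasure_one.tsum_eq
  · rw [hint a fun t => t ^ 2, integral_poissonMeasure]
    simpa using hasSum_sq_mul_poissonMeasure_one.tsum_eq

namespace IsUnitPoissonLike

variable {Ω : Type*} [MeasurableSpace Ω] {μ : Measure Ω} {X : ℕ → Ω → ℝ}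

theorem indepFun (hX : IsUnitPoissonLike X μ) {i j : ℕ} (h : i ≠ j) :
    IndepFun (X i) (X j) μ := by
  have := (hX.indep (i + j + 1)).indepFun (i := ⟨i, by omega⟩) (j := ⟨j, by omega⟩)
    (by simpa using h)
  exact this

theorem indepFun_mul (hX : IsUnitPoissonLike X μ) {i j k l : ℕ} (hik : i ≠ k) (hil : i ≠ l)
    (hjk : j ≠ k) (hjl : j ≠ l) : IndepFun (X i * X j) (X k * X l) μ :=
  (hX.indep (i + j + k + l + 1)).indepFun_mul_mul (fun _ => hX.meas _)
    ⟨i, by omega⟩ ⟨j, by omega⟩ ⟨k, by omega⟩ ⟨l, by omega⟩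
    (by simpa using hik) (by simpa using hil) (by simpa using hjk) (by simpa using hjl)

theorem integrable_mul (hX : IsUnitPoissonLike X μ) {i j : ℕ} (h : i ≠ j) :
    Integrable (fun ω => X i ω * X j ω) μ :=
  (hX.indepFun h).integrable_mul (hX.integrable i) (hX.integrable j)

theorem integral_mul (hX : IsUnitPoissonLike X μ) {i j : ℕ} (h : i ≠ j) :
    ∫ ω, X i ω * X j ω ∂μ = 1 := by
  have := (hX.indepFun h).integral_mul_eq_mul_integral (hX.meas i).aestronglyMeasurable
    (hX.meas j).aestronglyMeasurable
  simpa [hX.integral] using this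

theorem indepFun_sq (hX : IsUnitPoissonLike X μ) {i j : ℕ} (h : i ≠ j) :
    IndepFun (fun ω => X i ω ^ 2) (fun ω => X j ω ^ 2) μ :=
  (hX.indepFun h).comp (φ := fun t : ℝ => t ^ 2) (ψ := fun t : ℝ => t ^ 2)
    (by fun_prop) (by fun_prop)

theorem integrable_mul_sq (hX : IsUnitPoissonLike X μ) {i j : ℕ} (h : i ≠ j) :
    Integrable (fun ω => (X i ω * X j ω) ^ 2) μ := by
  simp only [mul_pow]
  exact (hX.indepFun_sq h).integrable_mul (hX.integrable_sq i) (hX.integrable_sq j)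

theorem integral_mul_sq (hX : IsUnitPoissonLike X μ) {i j : ℕ} (h : i ≠ j) :
    ∫ ω, (X i ω * X j ω) ^ 2 ∂μ = 4 := by
  have := (hX.indepFun_sq h).integral_mul_eq_mul_integral
    (hX.integrable_sq i).aestronglyMeasurable (hX.integrable_sq j).aestronglyMeasurable
  simp only [Pi.mul_apply, hX.integral_sq] at this
  simp only [mul_pow, this]
  norm_num

theorem memLp_mul_sub_one [IsProbabilityMeasure μ] (hX : IsUnitPoissonLike X μ) {i j : ℕ}
    (h : i ≠ j) : MemLp (fun ω => X i ω * X j ω - 1) 2 μ := by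
  refine MemLp.sub ?_ (memLp_const 1)
  exact (memLp_two_iff_integrable_sq ((hX.meas i).mul (hX.meas j)).aestronglyMeasurable).2
    (hX.integrable_mul_sq h)

theorem integral_mul_sub_one_sq [IsProbabilityMeasure μ] (hX : IsUnitPoissonLike X μ) {i j : ℕ}
    (h : i ≠ j) : ∫ ω, (X i ω * X j ω - 1) ^ 2 ∂μ = 3 := by
  have h1 : ∀ ω, (X i ω * X j ω - 1) ^ 2 = (X i ω * X j ω) ^ 2 - 2 * (X i ω * X j ω) + 1 :=
    fun ω => by ring
  simp only [h1]
  rw [integral_add, integral_sub, integral_const_mul, hX.integral_mul h, hX.integral_mul_sq h]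
  · norm_num
  · exact hX.integrable_mul_sq h
  · exact (hX.integrable_mul h).const_mul 2
  · exact (hX.integrable_mul_sq h).sub ((hX.integrable_mul h).const_mul 2)
  · exact integrable_const 1

/-- By `2 u v ≤ u² + v²` the covariance is at most the common variance `2 * 2 - 1 = 3`. -/
theorem integral_cross_le [IsProbabilityMeasure μ] (hX : IsUnitPoissonLike X μ) {i j k l : ℕ}
    (hij : i ≠ j) (hkl : k ≠ l) :
    ∫ ω, (X i ω * X j ω - 1) * (X k ω * X l ω - 1) ∂μ ≤ 3 := by
  have hp := (hX.memLp_mul_sub_one hij).integrable_sq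
  have hq := (hX.memLp_mul_sub_one hkl).integrable_sq
  calc ∫ ω, (X i ω * X j ω - 1) * (X k ω * X l ω - 1) ∂μ
      ≤ ∫ ω, ((X i ω * X j ω - 1) ^ 2 + (X k ω * X l ω - 1) ^ 2) / 2 ∂μ := by
        refine integral_mono ((hX.memLp_mul_sub_one hij).integrable_mul
          (hX.memLp_mul_sub_one hkl)) ((hp.add hq).div_const 2) fun ω => ?_
        simp only
        nlinarith [sq_nonneg ((X i ω * X j ω - 1) - (X k ω * X l ω - 1))]
    _ = 3 := by
        rw [integral_div, integral_add hp hq, hX.integral_mul_sub_one_sq hij,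
          hX.integral_mul_sub_one_sq hkl]
        norm_num

theorem integral_cross_eq_zero [IsProbabilityMeasure μ] (hX : IsUnitPoissonLike X μ)
    {i j k l : ℕ} (hij : i ≠ j) (hkl : k ≠ l) (hik : i ≠ k) (hil : i ≠ l) (hjk : j ≠ k)
    (hjl : j ≠ l) : ∫ ω, (X i ω * X j ω - 1) * (X k ω * X l ω - 1) ∂μ = 0 := by
  have h := ((hX.indepFun_mul hik hil hjk hjl).comp (φ := fun t : ℝ => t - 1)
    (ψ := fun t : ℝ => t - 1) (by fun_prop) (by fun_prop)).integral_mul_eq_mul_integral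
    ((hX.memLp_mul_sub_one hij).aestronglyMeasurable)
    ((hX.memLp_mul_sub_one hkl).aestronglyMeasurable)
  simp only [Pi.mul_apply, Function.comp_apply] at h
  rw [h, integral_sub (hX.integrable_mul hij) (integrable_const 1), hX.integral_mul hij]
  simp

end IsUnitPoissonLike

/-! ### Mean and variance of the quadratic form. -/

theorem sum_pairs_eq (M : ℕ) (f : ℕ → ℕ → ℝ) :
    ∑ p ∈ Finset.range M ×ˢ Finset.range M with p.1 < p.2, f p.1 p.2 =
      ∑ b ∈ Finset.range M, ∑ a ∈ Finset.range b, f a b := by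
  rw [Finset.sum_filter, Finset.sum_product_right]
  refine Finset.sum_congr rfl fun b hb => ?_
  rw [← Finset.sum_filter]
  refine Finset.sum_congr ?_ fun _ _ => rfl
  ext a
  simp only [Finset.mem_filter, Finset.mem_range] at hb ⊢
  omega

theorem sum_range_sub_eq (w : ℕ → ℝ) (b : ℕ) :
    ∑ a ∈ Finset.range b, w (b - a) = ∑ d ∈ Finset.Ico 1 (b + 1), w d := by
  rw [Finset.sum_Ico_eq_sum_range, ← Finset.sum_range_reflect]
  refine Finset.sum_congr rfl fun a ha => ?_
  simp only [Finset.mem_range] at ha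
  congr 1
  omega

/-- The mean of `pairSum` for unit means, summed by differences. -/
theorem sum_pairs_sub_eq (M : ℕ) (w : ℕ → ℝ) :
    ∑ p ∈ Finset.range M ×ˢ Finset.range M with p.1 < p.2, w (p.2 - p.1) =
      ∑ d ∈ Finset.Ico 1 M, ((M : ℝ) - d) * w d := by
  rw [sum_pairs_eq M fun a b => w (b - a)]
  simp only [sum_range_sub_eq]
  induction M with
  | zero => simp
  | succ M ih =>
    rw [Finset.sum_range_succ, ih]
    have h : ∑ d ∈ Finset.Ico 1 M, ((M : ℝ) - d) * w d =
        ∑ d ∈ Finset.Ico 1 (M + 1), ((M : ℝ) - d) * w d := by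
      rcases Nat.eq_zero_or_pos M with rfl | hM
      · simp
      · rw [Finset.sum_Ico_succ_top hM]
        simp
    rw [h, ← Finset.sum_add_distrib]
    refine Finset.sum_congr rfl fun d _ => ?_
    push_cast
    ring

/-- Once one end of a pair is fixed, the difference determines the pair, so each `w d` is used at
most once. -/
theorem sum_pairs_fst_le (M : ℕ) {w : ℕ → ℝ} (hw : ∀ d, 0 ≤ w d) (i : ℕ) :
    ∑ q ∈ Finset.range M ×ˢ Finset.range M with q.1 < q.2,
      (if q.1 = i then w (q.2 - q.1) else 0) ≤ ∑ d ∈ Finset.Ico 1 M, w d := by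
  rw [← Finset.sum_filter, Finset.filter_filter]
  have hinj : Set.InjOn (fun q : ℕ × ℕ => q.2 - q.1) ((Finset.range M ×ˢ Finset.range M).filter
      fun q => q.1 < q.2 ∧ q.1 = i) := by
    rintro ⟨a, b⟩ h ⟨a', b'⟩ h' heq
    simp only [Finset.coe_filter, Finset.mem_product, Finset.mem_range, Set.mem_ofPred_eq] at h h'
    simp only at heq
    ext <;> simp only <;> omega
  rw [← Finset.sum_image (f := w) hinj]
  refine Finset.sum_le_sum_of_subset_of_nonneg ?_ fun d _ _ => hw d
  intro d hd
  simp only [Finset.mem_image, Finset.mem_filter, Finset.mem_product, Finset.mem_range] at hd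
  obtain ⟨q, hq, rfl⟩ := hd
  simp only [Finset.mem_Ico]
  omega

theorem sum_pairs_snd_le (M : ℕ) {w : ℕ → ℝ} (hw : ∀ d, 0 ≤ w d) (i : ℕ) :
    ∑ q ∈ Finset.range M ×ˢ Finset.range M with q.1 < q.2,
      (if q.2 = i then w (q.2 - q.1) else 0) ≤ ∑ d ∈ Finset.Ico 1 M, w d := by
  rw [← Finset.sum_filter, Finset.filter_filter]
  have hinj : Set.InjOn (fun q : ℕ × ℕ => q.2 - q.1) ((Finset.range M ×ˢ Finset.range M).filter
      fun q => q.1 < q.2 ∧ q.2 = i) := by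
    rintro ⟨a, b⟩ h ⟨a', b'⟩ h' heq
    simp only [Finset.coe_filter, Finset.mem_product, Finset.mem_range, Set.mem_ofPred_eq] at h h'
    simp only at heq
    ext <;> simp only <;> omega
  rw [← Finset.sum_image (f := w) hinj]
  refine Finset.sum_le_sum_of_subset_of_nonneg ?_ fun d _ _ => hw d
  intro d hd
  simp only [Finset.mem_image, Finset.mem_filter, Finset.mem_product, Finset.mem_range] at hd
  obtain ⟨q, hq, rfl⟩ := hd
  simp only [Finset.mem_Ico]
  omega

namespace IsUnitPoissonLike

variable {Ω : Type*} [MeasurableSpace Ω] {μ : Measure Ω} [IsProbabilityMeasure μ]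
  {X : ℕ → Ω → ℝ}

omit [IsProbabilityMeasure μ] in
theorem memLp_pairSum (hX : IsUnitPoissonLike X μ) (M : ℕ) (w : ℕ → ℝ) :
    MemLp (fun ω => pairSum M w (fun a => X a ω)) 2 μ := by
  refine memLp_finsetSum _ fun p hp => ?_
  simp only [Finset.mem_filter] at hp
  refine MemLp.const_mul ?_ _
  exact (memLp_two_iff_integrable_sq ((hX.meas _).mul (hX.meas _)).aestronglyMeasurable).2
    (hX.integrable_mul_sq hp.2.ne)

/-- Variance bound for the quadratic form. -/
theorem integral_pairSum_sub_sq_le (hX : IsUnitPoissonLike X μ) (M : ℕ) {w : ℕ → ℝ}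
    (hw : ∀ d, 0 ≤ w d) :
    ∫ ω, (pairSum M w (fun a => X a ω) - ∑ d ∈ Finset.Ico 1 M, ((M : ℝ) - d) * w d) ^ 2 ∂μ ≤
      12 * (∑ d ∈ Finset.Ico 1 M, ((M : ℝ) - d) * w d) * ∑ d ∈ Finset.Ico 1 M, w d := by
  rw [← sum_pairs_sub_eq]
  set Q := (Finset.range M ×ˢ Finset.range M).filter fun p => p.1 < p.2 with hQ
  set A := ∑ d ∈ Finset.Ico 1 M, w d with hA
  set Y : ℕ × ℕ → Ω → ℝ := fun p ω => X p.1 ω * X p.2 ω - 1 with hY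
  have hlt : ∀ p ∈ Q, p.1 < p.2 := fun p hp => (Finset.mem_filter.1 hp).2
  have hexp : ∀ ω, (pairSum M w (fun a => X a ω) - ∑ p ∈ Q, w (p.2 - p.1)) ^ 2 =
      ∑ p ∈ Q, ∑ q ∈ Q, w (p.2 - p.1) * w (q.2 - q.1) * (Y p ω * Y q ω) := by
    intro ω
    rw [pairSum, ← hQ, ← Finset.sum_sub_distrib, sq, Finset.sum_mul_sum]
    refine Finset.sum_congr rfl fun p _ => Finset.sum_congr rfl fun q _ => ?_
    simp only [hY]
    ring
  have hYint : ∀ p ∈ Q, ∀ q ∈ Q, Integrable (fun ω => Y p ω * Y q ω) μ := fun p hp q hq =>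
    (hX.memLp_mul_sub_one (hlt p hp).ne).integrable_mul (hX.memLp_mul_sub_one (hlt q hq).ne)
  -- Only pairs sharing an index contribute, at most 3 each. There are four ways to share one, and
  -- each sums to at most `A`: hence the constant 12.
  have hcov : ∀ p ∈ Q, ∀ q ∈ Q, w (p.2 - p.1) * w (q.2 - q.1) * ∫ ω, Y p ω * Y q ω ∂μ ≤
      w (p.2 - p.1) * (3 * ((((if q.1 = p.1 then w (q.2 - q.1) else 0) +
        (if q.1 = p.2 then w (q.2 - q.1) else 0)) + (if q.2 = p.1 then w (q.2 - q.1) else 0)) +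
        (if q.2 = p.2 then w (q.2 - q.1) else 0))) := by
    intro p hp q hq
    rw [mul_assoc]
    refine mul_le_mul_of_nonneg_left ?_ (hw _)
    have h0 := hw (q.2 - q.1)
    by_cases hshare : q.1 = p.1 ∨ q.1 = p.2 ∨ q.2 = p.1 ∨ q.2 = p.2
    · have h3 := hX.integral_cross_le (hlt p hp).ne (hlt q hq).ne
      have h4 : w (q.2 - q.1) ≤ (((if q.1 = p.1 then w (q.2 - q.1) else 0) +
        (if q.1 = p.2 then w (q.2 - q.1) else 0)) + (if q.2 = p.1 then w (q.2 - q.1) else 0)) +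
        (if q.2 = p.2 then w (q.2 - q.1) else 0) := by
        split_ifs <;> first | linarith | (exfalso; omega)
      have h5 := mul_le_mul_of_nonneg_left h3 h0
      linarith
    · push Not at hshare
      obtain ⟨h1, h2, h3, h4⟩ := hshare
      rw [hX.integral_cross_eq_zero (hlt p hp).ne (hlt q hq).ne h1.symm h3.symm h2.symm h4.symm,
        if_neg h1, if_neg h2, if_neg h3, if_neg h4]
      simp
  calc ∫ ω, (pairSum M w (fun a => X a ω) - ∑ p ∈ Q, w (p.2 - p.1)) ^ 2 ∂μ
      = ∑ p ∈ Q, ∑ q ∈ Q, w (p.2 - p.1) * w (q.2 - q.1) * ∫ ω, Y p ω * Y q ω ∂μ := by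
        simp only [hexp]
        rw [integral_finsetSum _ fun p hp => integrable_finsetSum _ fun q hq =>
          (hYint p hp q hq).const_mul _]
        refine Finset.sum_congr rfl fun p hp => ?_
        rw [integral_finsetSum _ fun q hq => (hYint p hp q hq).const_mul _]
        exact Finset.sum_congr rfl fun q hq => integral_const_mul _ _
    _ ≤ ∑ p ∈ Q, w (p.2 - p.1) * (3 * (A + A + A + A)) := by
        refine Finset.sum_le_sum fun p hp => (Finset.sum_le_sum (hcov p hp)).trans ?_
        rw [← Finset.mul_sum, ← Finset.mul_sum, Finset.sum_add_distrib, Finset.sum_add_distrib,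
          Finset.sum_add_distrib]
        refine mul_le_mul_of_nonneg_left ?_ (hw _)
        refine mul_le_mul_of_nonneg_left ?_ (by norm_num)
        gcongr
        · exact sum_pairs_fst_le M hw _
        · exact sum_pairs_fst_le M hw _
        · exact sum_pairs_snd_le M hw _
        · exact sum_pairs_snd_le M hw _
    _ = 12 * (∑ p ∈ Q, w (p.2 - p.1)) * A := by
        rw [← Finset.sum_mul]
        ring

end IsUnitPoissonLike

/-! ### Convergence of the Laplace functional. -/

theorem abs_exp_neg_sub_exp_neg_le {x y : ℝ} (hx : 0 ≤ x) (hy : 0 ≤ y) :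
    |Real.exp (-x) - Real.exp (-y)| ≤ |x - y| := by
  wlog h : x ≤ y generalizing x y
  · rw [abs_sub_comm, abs_sub_comm x]
    exact this hy hx (le_of_not_ge h)
  have h1 : Real.exp (-y) ≤ Real.exp (-x) := Real.exp_le_exp.2 (by linarith)
  rw [abs_of_nonneg (by linarith), abs_sub_comm, abs_of_nonneg (by linarith)]
  have h2 : Real.exp (-y) = Real.exp (-x) * Real.exp (x - y) := by
    rw [← Real.exp_add]
    congr 1
    ring
  have h3 := Real.add_one_le_exp (x - y)
  have h4 : Real.exp (-x) ≤ 1 := Real.exp_le_one_iff.2 (by linarith)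
  have h5 := Real.exp_pos (-x)
  nlinarith

/-- Concentration: the Laplace functional of the quadratic form converges. -/
theorem tendsto_integral_exp_neg_pairSum {Ω : Type*} [MeasurableSpace Ω] {μ : Measure Ω}
    [IsProbabilityMeasure μ] {X : ℕ → ℕ → Ω → ℝ} (hX : ∀ n, IsUnitPoissonLike (X n) μ)
    {M : ℕ → ℕ} {w : ℕ → ℕ → ℝ} (hw : ∀ n d, 0 ≤ w n d) {c : ℝ}
    (hmean : Tendsto (fun n => ∑ d ∈ Finset.Ico 1 (M n), ((M n : ℝ) - d) * w n d) atTop (𝓝 c))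
    (hmass : Tendsto (fun n => ∑ d ∈ Finset.Ico 1 (M n), w n d) atTop (𝓝 0)) :
    Tendsto (fun n => ∫ ω, Real.exp (-pairSum (M n) (w n) (fun a => X n a ω)) ∂μ) atTop
      (𝓝 (Real.exp (-c))) := by
  set m : ℕ → ℝ := fun n => ∑ d ∈ Finset.Ico 1 (M n), ((M n : ℝ) - d) * w n d with hm
  set A : ℕ → ℝ := fun n => ∑ d ∈ Finset.Ico 1 (M n), w n d with hA
  have hm0 : ∀ n, 0 ≤ m n := fun n => Finset.sum_nonneg fun d hd => by
    rw [Finset.mem_Ico] at hd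
    have : (d : ℝ) ≤ M n := by exact_mod_cast hd.2.le
    exact mul_nonneg (by linarith) (hw n d)
  have hdiff : Tendsto (fun n => ∫ ω, Real.exp (-pairSum (M n) (w n) (fun a => X n a ω)) ∂μ -
      Real.exp (-m n)) atTop (𝓝 0) := by
    rw [Metric.tendsto_atTop]
    intro ε hε
    have hv : Tendsto (fun n => 12 * m n * A n) atTop (𝓝 0) := by
      simpa using (hmean.const_mul 12).mul hmass
    obtain ⟨n₀, hn₀⟩ := (Metric.tendsto_atTop.1 hv) (ε ^ 2 / 4) (by positivity)
    refine ⟨n₀, fun n hn => ?_⟩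
    have hvn := hn₀ n hn
    rw [Real.dist_eq, sub_zero] at hvn ⊢
    have hvn' := (le_abs_self _).trans_lt hvn
    set W : Ω → ℝ := fun ω => pairSum (M n) (w n) (fun a => X n a ω) with hW
    have hWmeas : Measurable W := measurable_pairSum (hX n).meas _ _
    have hW0 : ∀ ω, 0 ≤ W ω := fun ω => pairSum_nonneg (hw n) fun a => (hX n).nonneg a ω
    have hint := integrable_exp_neg_of_nonneg (μ := μ) hWmeas hW0
    have hsq : Integrable (fun ω => (W ω - m n) ^ 2) μ :=
      (((hX n).memLp_pairSum (M n) (w n)).sub (memLp_const (m n))).integrable_sq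
    calc |∫ ω, Real.exp (-W ω) ∂μ - Real.exp (-m n)|
        = |∫ ω, (Real.exp (-W ω) - Real.exp (-m n)) ∂μ| := by
          rw [integral_sub hint (integrable_const _)]
          simp
      _ ≤ ∫ ω, |Real.exp (-W ω) - Real.exp (-m n)| ∂μ := abs_integral_le_integral_abs
      -- The inequality `t ≤ ε / 2 + 2 t² / ε` passes directly to the variance; with variance below
      -- `ε² / 4` the total is below `ε`.
      _ ≤ ∫ ω, (ε / 2 + (W ω - m n) ^ 2 * (2 / ε)) ∂μ := by
          refine integral_mono (hint.sub (integrable_const _)).abs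
            ((integrable_const _).add (hsq.mul_const _)) fun ω => ?_
          refine (abs_exp_neg_sub_exp_neg_le (hW0 ω) (hm0 n)).trans ?_
          rw [← sq_abs (W ω - m n)]
          set t := |W ω - m n|
          have h0 : ε / 2 + t ^ 2 * (2 / ε) - t = ((t - ε / 4) ^ 2 + 3 * ε ^ 2 / 16) * (2 / ε) := by
            field_simp
            ring
          have : 0 ≤ ((t - ε / 4) ^ 2 + 3 * ε ^ 2 / 16) * (2 / ε) := by positivity
          linarith
      _ = ε / 2 + (∫ ω, (W ω - m n) ^ 2 ∂μ) * (2 / ε) := by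
          rw [integral_add (integrable_const _) (hsq.mul_const _), integral_mul_const]
          simp
      _ < ε / 2 + ε ^ 2 / 4 * (2 / ε) := by
          have := ((hX n).integral_pairSum_sub_sq_le (M n) (hw n)).trans_lt hvn'
          gcongr
      _ = ε := by
          field_simp
          ring
  have hlim := (Real.continuous_exp.tendsto (-c)).comp hmean.neg
  simpa using hdiff.add hlim

/-! ### Power sums beyond a growing threshold. -/

theorem antitoneOn_rpow_neg {β : ℝ} (hβ : 0 ≤ β) {a b : ℝ} (ha : 0 < a) :
    AntitoneOn (fun x : ℝ => x ^ (-β)) (Set.Icc a b) := fun _ hx _ _ hxy =>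
  Real.rpow_le_rpow_of_nonpos (ha.trans_le hx.1) hxy (by linarith)

theorem sum_Ioc_rpow_neg_le_integral {β : ℝ} (hβ : 0 ≤ β) {a b : ℕ} (ha : 0 < a) (hab : a ≤ b) :
    ∑ e ∈ Finset.Ioc a b, (e : ℝ) ^ (-β) ≤ ∫ x in (a : ℝ)..b, x ^ (-β) := by
  have h := (antitoneOn_rpow_neg hβ (Nat.cast_pos.2 ha) (b := b)).sum_le_integral_Ico hab
  rwa [Finset.sum_Ico_add' (fun e : ℕ => (e : ℝ) ^ (-β)) a b 1,
    Finset.Ico_add_one_add_one_eq_Ioc] at h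

theorem integral_le_sum_Ioc_rpow_neg {β : ℝ} (hβ : 0 ≤ β) {a b : ℕ} (hab : a ≤ b) :
    ∫ x in ((a : ℝ) + 1)..((b : ℝ) + 1), x ^ (-β) ≤ ∑ e ∈ Finset.Ioc a b, (e : ℝ) ^ (-β) := by
  have h := (antitoneOn_rpow_neg hβ (a := ((a + 1 : ℕ) : ℝ)) (Nat.cast_pos.2 a.succ_pos)
    (b := (b + 1 : ℕ))).integral_le_sum_Ico (by omega)
  rw [Finset.Ico_add_one_add_one_eq_Ioc] at h
  exact_mod_cast h

theorem integral_rpow_neg {β : ℝ} (hβ : β ≠ 1) {a b : ℝ} (ha : 0 < a) (hab : a ≤ b) :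
    ∫ x in a..b, x ^ (-β) = (a ^ (1 - β) - b ^ (1 - β)) / (β - 1) := by
  rw [integral_rpow]
  · have h1 : β - 1 ≠ 0 := sub_ne_zero.2 hβ
    have h2 : -β + 1 ≠ 0 := by
      intro h
      apply h1
      linarith
    rw [show -β + 1 = 1 - β by ring, div_eq_div_iff (by rwa [← show -β + 1 = 1 - β by ring]) h1]
    ring
  · refine Or.inr ⟨fun h => hβ (by linarith), ?_⟩
    rw [Set.uIcc_of_le hab]
    exact fun h => ha.not_ge h.1

theorem integral_rpow_neg_one {a b : ℝ} (ha : 0 < a) (hab : a ≤ b) :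
    ∫ x in a..b, x ^ (-1 : ℝ) = Real.log (b / a) := by
  simp only [Real.rpow_neg_one]
  exact integral_inv_of_pos ha (ha.trans_le hab)

theorem sum_Ioc_sub_mul_rpow_neg (α : ℝ) (a b : ℕ) :
    ∑ e ∈ Finset.Ioc a b, ((b : ℝ) - e) * (e : ℝ) ^ (-α) =
      b * ∑ e ∈ Finset.Ioc a b, (e : ℝ) ^ (-α) - ∑ e ∈ Finset.Ioc a b, (e : ℝ) ^ (-(α - 1)) := by
  rw [Finset.mul_sum, ← Finset.sum_sub_distrib]
  refine Finset.sum_congr rfl fun e he => ?_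
  have he : (0 : ℝ) < e := Nat.cast_pos.2 ((Nat.zero_le _).trans_lt (Finset.mem_Ioc.1 he).1)
  rw [show -(α - 1) = -α + 1 by ring, Real.rpow_add_one he.ne']
  ring

theorem tendsto_div_one_of_abs_sub_le {b ρ : ℕ → ℝ} {C : ℝ} (hρ : Tendsto ρ atTop atTop)
    (h : ∀ᶠ n in atTop, |b n - ρ n| ≤ C) : Tendsto (fun n => b n / ρ n) atTop (𝓝 1) := by
  have h1 : Tendsto (fun n => (b n - ρ n) / ρ n) atTop (𝓝 0) := by
    refine squeeze_zero_norm' ?_ (hρ.const_div_atTop C)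
    filter_upwards [h, hρ.eventually_gt_atTop 0] with n hn h0
    rw [norm_div, Real.norm_eq_abs, Real.norm_eq_abs, abs_of_pos h0]
    gcongr
  have h2 := h1.add_const 1
  rw [zero_add] at h2
  refine h2.congr' ?_
  filter_upwards [hρ.eventually_gt_atTop 0] with n h0
  field_simp
  ring

theorem tendsto_atTop_of_abs_sub_le {b ρ : ℕ → ℝ} {C : ℝ} (hρ : Tendsto ρ atTop atTop)
    (h : ∀ᶠ n in atTop, |b n - ρ n| ≤ C) : Tendsto b atTop atTop := by
  refine tendsto_atTop_mono' atTop ?_ (tendsto_atTop_add_const_right atTop (-C) hρ)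
  filter_upwards [h] with n hn
  linarith [(abs_le.1 hn).1]

/-- A bounded shift of a quantity tending to infinity is invisible: `b n / ρ n → 1`, and so is the
limit of its power. -/
theorem tendsto_mul_rpow_of_abs_sub_le {b ρ N : ℕ → ℝ} {C K β : ℝ} (hρ : Tendsto ρ atTop atTop)
    (h : ∀ᶠ n in atTop, |b n - ρ n| ≤ C) (hK : Tendsto (fun n => N n * ρ n ^ β) atTop (𝓝 K)) :
    Tendsto (fun n => N n * b n ^ β) atTop (𝓝 K) := by
  have h1 := (tendsto_div_one_of_abs_sub_le hρ h).rpow_const (p := β) (Or.inl one_ne_zero)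
  have h2 := hK.mul h1
  rw [Real.one_rpow, mul_one] at h2
  refine h2.congr' ?_
  filter_upwards [hρ.eventually_gt_atTop 0,
    (tendsto_atTop_of_abs_sub_le hρ h).eventually_gt_atTop 0] with n h0 h3
  rw [Real.div_rpow h3.le h0.le]
  have := (Real.rpow_pos_of_pos h0 β).ne'
  field_simp

theorem tendsto_rpow_zero_of_neg {N : ℕ → ℝ} (hN : Tendsto N atTop atTop) {β : ℝ} (hβ : β < 0) :
    Tendsto (fun n => N n ^ β) atTop (𝓝 0) := by
  have := (tendsto_rpow_neg_atTop (neg_pos.2 hβ)).comp hN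
  simpa [Function.comp_def] using this

section

variable {α : ℝ} {a N : ℕ → ℕ} {ρ : ℕ → ℝ} {C : ℝ}

theorem tendsto_sum_rpow_neg_zero (hα : 1 < α) (ha : Tendsto a atTop atTop) :
    Tendsto (fun n => ∑ e ∈ Finset.Ioc (a n) (N n), (e : ℝ) ^ (-α)) atTop (𝓝 0) := by
  have ha' : Tendsto (fun n => (a n : ℝ)) atTop atTop := tendsto_natCast_atTop_atTop.comp ha
  have hlim : Tendsto (fun n => (a n : ℝ) ^ (1 - α) / (α - 1)) atTop (𝓝 0) := by
    simpa using (tendsto_rpow_zero_of_neg ha' (β := 1 - α) (by linarith)).div_const (α - 1)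
  refine tendsto_of_tendsto_of_tendsto_of_le_of_le' tendsto_const_nhds hlim ?_ ?_
  · exact Eventually.of_forall fun n => Finset.sum_nonneg fun _ _ =>
      Real.rpow_nonneg (Nat.cast_nonneg _) _
  · filter_upwards [ha.eventually_gt_atTop 0] with n hn
    have h0 : (0 : ℝ) < a n := Nat.cast_pos.2 hn
    rcases le_total (a n) (N n) with h | h
    · refine (sum_Ioc_rpow_neg_le_integral (by linarith) hn h).trans ?_
      rw [integral_rpow_neg hα.ne' h0 (Nat.cast_le.2 h)]
      have : (0 : ℝ) ≤ (N n : ℝ) ^ (1 - α) := Real.rpow_nonneg (Nat.cast_nonneg _) _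
      have : 0 ≤ α - 1 := by linarith
      gcongr
      linarith
    · rw [Finset.Ioc_eq_empty_of_le h, Finset.sum_empty]
      exact div_nonneg (Real.rpow_nonneg h0.le _) (by linarith)

/-- Long range sums when the threshold is such that `N ρ^{1-α}` converges. -/
theorem tendsto_mul_sum_rpow_neg (hα : 1 < α) {K D : ℝ} (hρ : Tendsto ρ atTop atTop)
    (ha : ∀ᶠ n in atTop, |(a n : ℝ) - ρ n| ≤ C) (haN : ∀ᶠ n in atTop, a n ≤ N n)
    (hN : Tendsto N atTop atTop)
    (hK : Tendsto (fun n => (N n : ℝ) * ρ n ^ (1 - α)) atTop (𝓝 K))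
    (hD : Tendsto (fun n => (N n : ℝ) * (N n : ℝ) ^ (1 - α)) atTop (𝓝 D)) :
    Tendsto (fun n => (N n : ℝ) * ∑ e ∈ Finset.Ioc (a n) (N n), (e : ℝ) ^ (-α)) atTop
      (𝓝 ((K - D) / (α - 1))) := by
  have hN' : Tendsto (fun n => (N n : ℝ)) atTop atTop := tendsto_natCast_atTop_atTop.comp hN
  have hup : Tendsto (fun n => ((N n : ℝ) * (a n : ℝ) ^ (1 - α) -
      (N n : ℝ) * (N n : ℝ) ^ (1 - α)) / (α - 1)) atTop (𝓝 ((K - D) / (α - 1))) :=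
    ((tendsto_mul_rpow_of_abs_sub_le hρ ha hK).sub hD).div_const _
  have hlo : Tendsto (fun n => ((N n : ℝ) * ((a n : ℝ) + 1) ^ (1 - α) -
      (N n : ℝ) * ((N n : ℝ) + 1) ^ (1 - α)) / (α - 1)) atTop (𝓝 ((K - D) / (α - 1))) := by
    refine Tendsto.div_const (Tendsto.sub ?_ ?_) _
    · refine tendsto_mul_rpow_of_abs_sub_le (C := C + 1) hρ ?_ hK
      filter_upwards [ha] with n hn
      rw [abs_le] at hn ⊢
      constructor <;> linarith
    · exact tendsto_mul_rpow_of_abs_sub_le (C := 1) hN' (by simp) hD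
  have hapos := (tendsto_atTop_of_abs_sub_le hρ ha).eventually_gt_atTop 0
  refine tendsto_of_tendsto_of_tendsto_of_le_of_le' hlo hup ?_ ?_
  · filter_upwards [haN] with n h
    have hle : (a n : ℝ) ≤ N n := Nat.cast_le.2 h
    have := integral_le_sum_Ioc_rpow_neg (β := α) (by linarith) h
    rw [integral_rpow_neg hα.ne' (by positivity) (by linarith)] at this
    rw [← mul_sub, mul_div_assoc]
    gcongr
  · filter_upwards [haN, hapos] with n h h0
    have := sum_Ioc_rpow_neg_le_integral (β := α) (by linarith) (Nat.cast_pos.1 h0) h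
    rw [integral_rpow_neg hα.ne' h0 (Nat.cast_le.2 h)] at this
    rw [← mul_sub, mul_div_assoc]
    gcongr

/-- Split `(N - e) e ^ (-α)` as `N e ^ (-α) - e ^ (-(α - 1))`. The second part is a tail of a
convergent series because `α - 1 > 1`, and the upper end of the first vanishes because `N ^ (2 - α)
→ 0`. -/
theorem tendsto_sum_gt_two (hα : 2 < α) {K : ℝ} (hρ : Tendsto ρ atTop atTop)
    (ha : ∀ᶠ n in atTop, |(a n : ℝ) - ρ n| ≤ C) (haN : ∀ᶠ n in atTop, a n ≤ N n)
    (hN : Tendsto N atTop atTop)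
    (hK : Tendsto (fun n => (N n : ℝ) * ρ n ^ (1 - α)) atTop (𝓝 K)) :
    Tendsto (fun n => ∑ e ∈ Finset.Ioc (a n) (N n), ((N n : ℝ) - e) * (e : ℝ) ^ (-α)) atTop
      (𝓝 (K / (α - 1))) := by
  have hN' : Tendsto (fun n => (N n : ℝ)) atTop atTop := tendsto_natCast_atTop_atTop.comp hN
  have ha' : Tendsto a atTop atTop :=
    tendsto_natCast_atTop_iff.1 (tendsto_atTop_of_abs_sub_le hρ ha)
  have hD : Tendsto (fun n => (N n : ℝ) * (N n : ℝ) ^ (1 - α)) atTop (𝓝 0) := by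
    refine (tendsto_rpow_zero_of_neg hN' (β := 2 - α) (by linarith)).congr' ?_
    filter_upwards [hN'.eventually_gt_atTop 0] with n hn
    rw [show 2 - α = 1 - α + 1 by ring, Real.rpow_add_one hn.ne', mul_comm]
  simp only [sum_Ioc_sub_mul_rpow_neg]
  have := (tendsto_mul_sum_rpow_neg (by linarith) hρ ha haN hN hK hD).sub
    (tendsto_sum_rpow_neg_zero (N := N) (α := α - 1) (by linarith) ha')
  simpa using this

/-- At `α = 2` both ends of the range are of order `N`: the first part of the split gives `c - 1`,
the second is a harmonic sum with limit `log c`. -/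
theorem tendsto_sum_eq_two {c : ℝ} (hc : 0 < c) (hρ : Tendsto ρ atTop atTop)
    (ha : ∀ᶠ n in atTop, |(a n : ℝ) - ρ n| ≤ C) (haN : ∀ᶠ n in atTop, a n ≤ N n)
    (hN : Tendsto N atTop atTop)
    (hK : Tendsto (fun n => (N n : ℝ) / ρ n) atTop (𝓝 c)) :
    Tendsto (fun n => ∑ e ∈ Finset.Ioc (a n) (N n), ((N n : ℝ) - e) * (e : ℝ) ^ (-2 : ℝ)) atTop
      (𝓝 (c - 1 - Real.log c)) := by
  have hN' : Tendsto (fun n => (N n : ℝ)) atTop atTop := tendsto_natCast_atTop_atTop.comp hN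
  have hK' : Tendsto (fun n => (N n : ℝ) * ρ n ^ (-1 : ℝ)) atTop (𝓝 c) := by
    simpa only [Real.rpow_neg_one, div_eq_mul_inv] using hK
  have hD : Tendsto (fun n => (N n : ℝ) * (N n : ℝ) ^ (-1 : ℝ)) atTop (𝓝 1) := by
    refine tendsto_const_nhds.congr' ?_
    filter_upwards [hN'.eventually_gt_atTop 0] with n hn
    rw [Real.rpow_neg_one, mul_inv_cancel₀ hn.ne']
  have h1 : (1 : ℝ) - 2 = -1 := by norm_num
  have hmain := tendsto_mul_sum_rpow_neg (α := 2) (by norm_num) hρ ha haN hN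
    (by rwa [h1]) (by rwa [h1])
  have hapos := (tendsto_atTop_of_abs_sub_le hρ ha).eventually_gt_atTop 0
  have hup : Tendsto (fun n => Real.log ((N n : ℝ) / a n)) atTop (𝓝 (Real.log c)) := by
    refine Tendsto.log ?_ hc.ne'
    simpa only [Real.rpow_neg_one, div_eq_mul_inv] using
      tendsto_mul_rpow_of_abs_sub_le hρ ha hK'
  have hlo : Tendsto (fun n => Real.log (((N n : ℝ) + 1) / ((a n : ℝ) + 1))) atTop
      (𝓝 (Real.log c)) := by
    refine Tendsto.log ?_ hc.ne'
    have h2 : ∀ᶠ n in atTop, |((a n : ℝ) + 1) - ρ n| ≤ C + 1 := by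
      filter_upwards [ha] with n hn
      rw [abs_le] at hn ⊢
      constructor <;> linarith
    have h3 := (tendsto_mul_rpow_of_abs_sub_le hρ h2 hK').add
      (tendsto_rpow_zero_of_neg (tendsto_atTop_of_abs_sub_le hρ h2) (β := -1) (by norm_num))
    rw [add_zero] at h3
    refine h3.congr fun n => ?_
    rw [Real.rpow_neg_one]
    ring
  have hlog : Tendsto (fun n => ∑ e ∈ Finset.Ioc (a n) (N n), (e : ℝ) ^ (-(2 - 1) : ℝ)) atTop
      (𝓝 (Real.log c)) := by
    have h2 : (-(2 - 1) : ℝ) = -1 := by norm_num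
    rw [h2]
    refine tendsto_of_tendsto_of_tendsto_of_le_of_le' hlo hup ?_ ?_
    · filter_upwards [haN] with n h
      have hle : (a n : ℝ) ≤ N n := Nat.cast_le.2 h
      have := integral_le_sum_Ioc_rpow_neg (β := 1) (by norm_num) h
      rwa [integral_rpow_neg_one (by positivity) (by linarith)] at this
    · filter_upwards [haN, hapos] with n h h0
      have := sum_Ioc_rpow_neg_le_integral (β := 1) (by norm_num) (Nat.cast_pos.1 h0) h
      rwa [integral_rpow_neg_one h0 (Nat.cast_le.2 h)] at this
  simp only [sum_Ioc_sub_mul_rpow_neg]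
  have := hmain.sub hlog
  norm_num at this ⊢
  exact this

theorem sum_Ioc_sub_natCast {a b : ℕ} (hab : a ≤ b) :
    ∑ e ∈ Finset.Ioc a b, ((b : ℝ) - e) = ((b : ℝ) - a) * ((b : ℝ) - a - 1) / 2 := by
  induction b, hab using Nat.le_induction with
  | base => simp
  | succ b hab ih =>
    rw [Finset.sum_Ioc_succ_top hab]
    have h : ∀ e : ℕ, ((b + 1 : ℕ) : ℝ) - e = ((b : ℝ) - e) + 1 := fun e => by
      push_cast
      ring
    simp only [h, Finset.sum_add_distrib, ih, Finset.sum_const, Nat.card_Ioc, nsmul_eq_mul,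
      Nat.cast_sub hab]
    push_cast
    ring

/-- Sums over lengths close to the maximal one. -/
theorem tendsto_sum_near_max (hα : 0 < α) {L : ℝ} (hN : Tendsto N atTop atTop)
    (haN : ∀ᶠ n in atTop, a n ≤ N n)
    (hratio : Tendsto (fun n => (a n : ℝ) / N n) atTop (𝓝 1))
    (hL : Tendsto (fun n => ((N n : ℝ) - a n) * (N n : ℝ) ^ (-(α / 2))) atTop (𝓝 L)) :
    Tendsto (fun n => ∑ e ∈ Finset.Ioc (a n) (N n), ((N n : ℝ) - e) * (e : ℝ) ^ (-α)) atTop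
      (𝓝 (L ^ 2 / 2)) ∧
    Tendsto (fun n => ∑ e ∈ Finset.Ioc (a n) (N n), (e : ℝ) ^ (-α)) atTop (𝓝 0) := by
  have hN' : Tendsto (fun n => (N n : ℝ)) atTop atTop := tendsto_natCast_atTop_atTop.comp hN
  have hsmall := tendsto_rpow_zero_of_neg hN' (β := -(α / 2)) (by linarith)
  have hsq : ∀ᶠ n in atTop, ((N n : ℝ) ^ (-(α / 2))) ^ 2 = (N n : ℝ) ^ (-α) := by
    filter_upwards [hN'.eventually_gt_atTop 0] with n hn
    rw [sq, ← Real.rpow_add hn]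
    congr 1
    ring
  have hr : Tendsto (fun n => ((a n : ℝ) / N n) ^ (-α)) atTop (𝓝 1) := by
    simpa using hratio.rpow_const (p := -α) (Or.inl one_ne_zero)
  have hapos : ∀ᶠ n in atTop, (0 : ℝ) < a n := by
    filter_upwards [hratio.eventually (lt_mem_nhds (show (0 : ℝ) < 1 by norm_num)),
      hN'.eventually_gt_atTop 0] with n h1 h2
    exact (div_pos_iff_of_pos_right h2).1 h1
  have hra : ∀ᶠ n in atTop, ((a n : ℝ) / N n) ^ (-α) * (N n : ℝ) ^ (-α) = (a n : ℝ) ^ (-α) := by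
    filter_upwards [hN'.eventually_gt_atTop 0, hapos] with n hn h0
    rw [Real.div_rpow h0.le hn.le]
    have := (Real.rpow_pos_of_pos hn (-α)).ne'
    field_simp
  -- The sum with `e ^ (-α)` frozen at `N ^ (-α)`. Freezing at `a ^ (-α)` instead changes it by a
  -- factor tending to 1, which gives the squeeze.
  have hbase : Tendsto (fun n => ((N n : ℝ) - a n) * ((N n : ℝ) - a n - 1) / 2 *
      (N n : ℝ) ^ (-α)) atTop (𝓝 (L ^ 2 / 2)) := by
    have h := ((hL.mul (hL.sub hsmall)).div_const 2)
    rw [sub_zero, ← sq] at h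
    refine h.congr' ?_
    filter_upwards [hsq] with n hn
    rw [← hn]
    ring
  constructor
  · have hup := hbase.mul hr
    rw [mul_one] at hup
    refine tendsto_of_tendsto_of_tendsto_of_le_of_le' hbase hup ?_ ?_
    · filter_upwards [haN] with n h
      rw [← sum_Ioc_sub_natCast h, Finset.sum_mul]
      refine Finset.sum_le_sum fun e he => ?_
      rw [Finset.mem_Ioc] at he
      have he1 : (e : ℝ) ≤ N n := Nat.cast_le.2 he.2
      have he0 : (0 : ℝ) < e := Nat.cast_pos.2 (by omega)
      exact mul_le_mul_of_nonneg_left (Real.rpow_le_rpow_of_nonpos he0 he1 (by linarith))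
        (by linarith)
    · filter_upwards [haN, hra, hapos] with n h hn h0
      rw [mul_assoc, mul_comm ((N n : ℝ) ^ (-α)), hn, ← sum_Ioc_sub_natCast h, Finset.sum_mul]
      refine Finset.sum_le_sum fun e he => ?_
      rw [Finset.mem_Ioc] at he
      have he1 : (e : ℝ) ≤ N n := Nat.cast_le.2 he.2
      have he2 : (a n : ℝ) ≤ e := Nat.cast_le.2 he.1.le
      exact mul_le_mul_of_nonneg_left (Real.rpow_le_rpow_of_nonpos h0 he2 (by linarith))
        (by linarith)
  · have hup := (hL.mul hsmall).mul hr
    rw [mul_zero, zero_mul] at hup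
    refine tendsto_of_tendsto_of_tendsto_of_le_of_le' tendsto_const_nhds hup ?_ ?_
    · exact Eventually.of_forall fun n => Finset.sum_nonneg fun _ _ =>
        Real.rpow_nonneg (Nat.cast_nonneg _) _
    · filter_upwards [haN, hra, hapos, hsq] with n h hn h0 hs
      have h1 : ((N n : ℝ) - a n) * (N n : ℝ) ^ (-(α / 2)) * (N n : ℝ) ^ (-(α / 2)) *
          ((a n : ℝ) / N n) ^ (-α) = ((N n : ℝ) - a n) * (a n : ℝ) ^ (-α) := by
        rw [← hn, ← hs]
        ring
      rw [h1]
      refine (Finset.sum_le_card_nsmul _ _ ((a n : ℝ) ^ (-α)) fun e he => ?_).trans ?_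
      · rw [Finset.mem_Ioc] at he
        have he2 : (a n : ℝ) ≤ e := Nat.cast_le.2 he.1.le
        exact Real.rpow_le_rpow_of_nonpos h0 he2 (by linarith)
      · rw [Nat.card_Ioc, nsmul_eq_mul, Nat.cast_sub h]

end

/-! ### The constant `c_r` and the asymptotics of the threshold. -/

/-- The substitution `x = 2 / (1 + t)` carries `(0, 2]` to `[0, ∞)`, where the intermediate value
theorem is easy to apply. -/
theorem hFun_two_div_one_add {t : ℝ} (ht : 0 ≤ t) :
    hFun (2 / (1 + t)) = Real.exp t / (1 + t) := by
  have h1 : 1 + t ≠ 0 := by positivity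
  rw [hFun, show (2 - 2 / (1 + t)) / (2 / (1 + t)) = t by field_simp; ring]
  field_simp

theorem exists_hFun_eq {y : ℝ} (hy : 1 ≤ y) : ∃ x ∈ Set.Ioc (0 : ℝ) 2, hFun x = y := by
  have hcont : ContinuousOn (fun t : ℝ => Real.exp t / (1 + t)) (Set.Icc 0 (4 * y)) :=
    Real.continuous_exp.continuousOn.div (by fun_prop) fun t ht => by
      have := ht.1
      positivity
  -- The quadratic Taylor bound suffices: `1 + 4y + 8y² ≥ y (1 + 4y)`.
  have hlarge : y ≤ Real.exp (4 * y) / (1 + 4 * y) := by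
    rw [le_div_iff₀ (by positivity)]
    have := Real.quadratic_le_exp_of_nonneg (show 0 ≤ 4 * y by linarith)
    nlinarith
  obtain ⟨t, ht, hty⟩ := intermediate_value_Icc (show (0 : ℝ) ≤ 4 * y by linarith) hcont
    (show y ∈ Set.Icc (Real.exp 0 / (1 + 0)) (Real.exp (4 * y) / (1 + 4 * y)) by
      simpa using ⟨hy, hlarge⟩)
  have h0 : 0 ≤ t := ht.1
  refine ⟨2 / (1 + t), ⟨by positivity, ?_⟩, by rw [hFun_two_div_one_add h0]; exact hty⟩
  rw [div_le_iff₀ (by positivity)]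
  linarith

/-- Taking logarithms in `h (c_r) = r ^ (-1/2)` gives exactly the limit of the case `α = 2` with
ratio `2 / c_r`. The bound `c_r < 2` is strict because `h 2 = 1`. -/
theorem cConst_spec {r : ℝ} (hr : r ∈ Set.Ioo (0 : ℝ) 1) :
    0 < cConst r ∧ cConst r < 2 ∧
      2 / cConst r - 1 - Real.log (2 / cConst r) = -Real.log r / 2 := by
  have hlog : Real.log r < 0 := Real.log_neg hr.1 hr.2
  have hy : 1 ≤ r ^ (-(1 / 2) : ℝ) :=
    Real.one_le_rpow_of_pos_of_le_one_of_nonpos hr.1 hr.2.le (by norm_num)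
  obtain ⟨h1, h2⟩ := Function.invFunOn_mem (exists_hFun_eq hy)
  have h3 : hFun (cConst r) = r ^ (-(1 / 2) : ℝ) := Function.invFunOn_eq (exists_hFun_eq hy)
  change 0 < cConst r at h1
  change cConst r ≤ 2 at h2
  have h4 := congrArg Real.log h3
  rw [hFun, Real.log_mul (by positivity) (Real.exp_ne_zero _), Real.log_exp,
    Real.log_rpow hr.1] at h4
  have h5 : Real.log (2 / cConst r) = -Real.log (cConst r / 2) := by
    rw [← Real.log_inv, inv_div]
  have h6 : (2 - cConst r) / cConst r = 2 / cConst r - 1 := by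
    field_simp
  rw [h6] at h4
  refine ⟨h1, lt_of_le_of_ne h2 fun h => ?_, by rw [h5]; linarith⟩
  rw [h] at h4
  norm_num at h4
  have := hr.1
  have := hr.2
  rcases h4 with h4 | h4 | h4 <;> linarith

section

variable {α : ℝ} {a N : ℕ → ℕ} {ρ : ℕ → ℝ} {C : ℝ}

/-- One statement for all `α < 2`. With `u = N ^ (-(1 - α/2)) → 0`, the rescaled gap `(N - ρ) N ^
(-(α/2))` equals `(1 - ψ u) / u`, a difference quotient tending to `-ψ' 0 = L`. -/
theorem tendsto_sum_of_profile (hα : 0 < α) (hα2 : α < 2) {L : ℝ} (hL : 0 < L) {ψ : ℝ → ℝ}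
    (hψ0 : ψ 0 = 1) (hψ : HasDerivAt ψ (-L) 0) (hN : Tendsto N atTop atTop)
    (hρ : ∀ᶠ n in atTop, ρ n = N n * ψ ((N n : ℝ) ^ (-(1 - α / 2)))) :
    Tendsto ρ atTop atTop ∧ ∀ a : ℕ → ℕ, (∀ᶠ n in atTop, |(a n : ℝ) - ρ n| ≤ C) →
    Tendsto (fun n => ∑ e ∈ Finset.Ioc (a n) (N n), ((N n : ℝ) - e) * (e : ℝ) ^ (-α)) atTop
      (𝓝 (L ^ 2 / 2)) ∧
    Tendsto (fun n => ∑ e ∈ Finset.Ioc (a n) (N n), (e : ℝ) ^ (-α)) atTop (𝓝 0) := by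
  have hN' : Tendsto (fun n => (N n : ℝ)) atTop atTop := tendsto_natCast_atTop_atTop.comp hN
  have hu := tendsto_rpow_zero_of_neg hN' (β := -(1 - α / 2)) (by linarith)
  have hψu : Tendsto (fun n => ψ ((N n : ℝ) ^ (-(1 - α / 2)))) atTop (𝓝 1) := by
    have := hψ.continuousAt.tendsto.comp hu
    rwa [hψ0] at this
  have hNpos := hN'.eventually_gt_atTop 0
  have hρtop : Tendsto ρ atTop atTop := (hN'.atTop_mul_pos one_pos hψu).congr' <| by
    filter_upwards [hρ] with n hn using hn.symm
  have hgap : Tendsto (fun n => ((N n : ℝ) - ρ n) * (N n : ℝ) ^ (-(α / 2))) atTop (𝓝 L) := by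
    have hslope := hasDerivAt_iff_tendsto_slope.1 hψ
    have hu' : Tendsto (fun n => (N n : ℝ) ^ (-(1 - α / 2))) atTop (𝓝[≠] 0) := by
      refine tendsto_nhdsWithin_iff.2 ⟨hu, ?_⟩
      filter_upwards [hNpos] with n hn using (Real.rpow_pos_of_pos hn _).ne'
    have h := (hslope.comp hu').neg
    rw [neg_neg] at h
    refine h.congr' ?_
    filter_upwards [hρ, hNpos] with n hn h0
    have h1 : (N n : ℝ) * (N n : ℝ) ^ (-(α / 2)) * (N n : ℝ) ^ (-(1 - α / 2)) = 1 := by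
      rw [mul_assoc, ← Real.rpow_add h0, show -(α / 2) + -(1 - α / 2) = -1 by ring,
        Real.rpow_neg_one, mul_inv_cancel₀ h0.ne']
    have h2 := (Real.rpow_pos_of_pos h0 (-(1 - α / 2))).ne'
    rw [hn, Function.comp_apply, slope_def_field, hψ0, sub_zero, ← neg_div, div_eq_iff h2]
    linear_combination (-(1 - ψ ((N n : ℝ) ^ (-(1 - α / 2))))) * h1
  refine ⟨hρtop, fun a ha => ?_⟩
  have hratio : Tendsto (fun n => (a n : ℝ) / N n) atTop (𝓝 1) := by
    have h := (tendsto_div_one_of_abs_sub_le hρtop ha).mul hψu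
    rw [one_mul] at h
    refine h.congr' ?_
    filter_upwards [hρ, hNpos, hρtop.eventually_gt_atTop 0] with n hn h0 h1
    rw [div_mul_eq_mul_div, div_eq_div_iff h1.ne' h0.ne', hn]
    ring
  have hgap' : Tendsto (fun n => ((N n : ℝ) - a n) * (N n : ℝ) ^ (-(α / 2))) atTop (𝓝 L) := by
    have hs := (tendsto_rpow_zero_of_neg hN' (β := -(α / 2)) (by linarith))
    have herr : Tendsto (fun n => ((a n : ℝ) - ρ n) * (N n : ℝ) ^ (-(α / 2))) atTop (𝓝 0) := by
      refine squeeze_zero_norm' ?_ (by simpa using hs.const_mul C)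
      filter_upwards [ha] with n hn
      have h0 : 0 ≤ (N n : ℝ) ^ (-(α / 2)) := Real.rpow_nonneg (Nat.cast_nonneg _) _
      rw [norm_mul, Real.norm_eq_abs, Real.norm_eq_abs, abs_of_nonneg h0]
      gcongr
    have h := hgap.sub herr
    rw [sub_zero] at h
    exact h.congr fun n => by ring
  have haN : ∀ᶠ n in atTop, a n ≤ N n := by
    filter_upwards [hgap'.eventually (lt_mem_nhds hL), hNpos] with n hn h0
    have := (pos_iff_pos_of_mul_pos hn).2 (Real.rpow_pos_of_pos h0 _)
    exact_mod_cast (sub_pos.1 this).le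
  exact tendsto_sum_near_max hα hN haN hratio hgap'

end

theorem hasDerivAt_rpow_profile {p : ℝ} (hp : p ≠ 0) (L : ℝ) :
    HasDerivAt (fun u : ℝ => (1 - p * L * u) ^ (1 / p)) (-L) 0 := by
  have h1 : HasDerivAt (fun u : ℝ => 1 - p * L * u) (-(p * L)) 0 := by
    simpa using ((hasDerivAt_id (0 : ℝ)).const_mul (p * L)).const_sub 1
  have h2 := h1.rpow_const (p := 1 / p) (Or.inl (by simp))
  convert h2 using 1
  simp only [mul_zero, sub_zero, Real.one_rpow]
  field_simp

/-- The limit of `(1 - p L u) ^ (1 / p)` as `p → 0`; it serves the case `α = 1`. -/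
theorem hasDerivAt_exp_profile (L : ℝ) :
    HasDerivAt (fun u : ℝ => Real.exp (-(L * u))) (-L) 0 := by
  have h1 : HasDerivAt (fun u : ℝ => -(L * u)) (-L) 0 := by
    have h := ((hasDerivAt_id (0 : ℝ)).const_mul L).neg
    rw [mul_one] at h
    exact h
  simpa using h1.exp

theorem rpow_sub_rpow_eq_profile {N : ℝ} (hN : 0 < N) {p κ L : ℝ} (hp : 0 < p)
    (h : p * L * N ^ (-κ) ≤ 1) :
    (N ^ p - p * L * N ^ (p - κ)) ^ (1 / p) = N * (1 - p * L * N ^ (-κ)) ^ (1 / p) := by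
  have h1 : N ^ p - p * L * N ^ (p - κ) = N ^ p * (1 - p * L * N ^ (-κ)) := by
    rw [sub_eq_add_neg p, Real.rpow_add hN]
    ring
  rw [h1, Real.mul_rpow (by positivity) (by linarith), ← Real.rpow_mul hN.le,
    mul_one_div_cancel hp.ne', Real.rpow_one]

theorem tendsto_two_mul_atTop : Tendsto (fun n : ℕ => 2 * n) atTop atTop :=
  tendsto_id.const_mul_atTop' (by norm_num)

/-- The threshold tends to infinity, and sums over the lengths above it have the right limits,
also after a bounded shift. -/
theorem threshold_asymptotics {α : ℝ} (hα : 0 < α) {r : ℝ} (hr : r ∈ Set.Ioo (0 : ℝ) 1) (C : ℝ) :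
    Tendsto (threshold α r) atTop atTop ∧
    ∀ a : ℕ → ℕ, (∀ᶠ n in atTop, |(a n : ℝ) - threshold α r n| ≤ C) →
    Tendsto (fun n => ∑ e ∈ Finset.Ioc (a n) (2 * n),
      (((2 * n : ℕ) : ℝ) - e) * (e : ℝ) ^ (-α)) atTop (𝓝 (-Real.log r / 2)) ∧
    Tendsto (fun n => ∑ e ∈ Finset.Ioc (a n) (2 * n), (e : ℝ) ^ (-α)) atTop (𝓝 0) := by
  have hlog : Real.log r < 0 := Real.log_neg hr.1 hr.2
  have hN := tendsto_two_mul_atTop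
  have hN' : Tendsto (fun n : ℕ => ((2 * n : ℕ) : ℝ)) atTop atTop :=
    tendsto_natCast_atTop_atTop.comp hN
  have hL : 0 < √(-Real.log r) := Real.sqrt_pos.2 (by linarith)
  have hLsq : √(-Real.log r) ^ 2 / 2 = -Real.log r / 2 := by
    rw [Real.sq_sqrt (by linarith)]
  have hprofile : α < 2 → ∀ p : ℝ, 0 < p →
      (∀ᶠ n : ℕ in atTop, threshold α r n = (((2 * n : ℕ) : ℝ) ^ p -
        p * √(-Real.log r) * ((2 * n : ℕ) : ℝ) ^ (p - (1 - α / 2))) ^ (1 / p)) →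
      ∀ᶠ n : ℕ in atTop, threshold α r n = ((2 * n : ℕ) : ℝ) *
        (1 - p * √(-Real.log r) * ((2 * n : ℕ) : ℝ) ^ (-(1 - α / 2))) ^ (1 / p) := by
    intro hα2 p hp h
    have hu := (tendsto_rpow_zero_of_neg hN' (β := -(1 - α / 2)) (by linarith)).const_mul
      (p * √(-Real.log r))
    rw [mul_zero] at hu
    filter_upwards [h, hu.eventually (gt_mem_nhds one_pos), hN'.eventually_gt_atTop 0]
      with n h1 h2 h3
    rw [h1, rpow_sub_rpow_eq_profile h3 hp h2.le]
  rcases lt_trichotomy α 2 with h2 | rfl | h2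
  · rcases lt_trichotomy α 1 with h1 | rfl | h1
    · have h := hprofile h2 (1 - α) (by linarith) (Eventually.of_forall fun n => by
        rw [threshold, if_neg (by linarith), if_neg (by linarith), if_neg (by linarith),
          if_neg (by linarith), show 1 - α - (1 - α / 2) = -(α / 2) by ring]
        push_cast
        rw [Real.mul_rpow (z := -(α / 2)) (by norm_num) (Nat.cast_nonneg n)]
        congr 2
        ring)
      rw [← hLsq]
      exact tendsto_sum_of_profile hα h2 hL (by simp)
        (hasDerivAt_rpow_profile (by linarith) _) hN h
    · rw [← hLsq]
      refine tendsto_sum_of_profile hα h2 hL (by simp) (hasDerivAt_exp_profile _) hN ?_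
      filter_upwards [eventually_gt_atTop 0] with n hn
      have hn : (0 : ℝ) < n := Nat.cast_pos.2 hn
      rw [threshold, if_neg (by norm_num), if_neg (by norm_num), if_neg (by norm_num), if_pos rfl,
        gConst, ← Real.exp_mul]
      push_cast
      congr 2
      -- The exponents agree: `√(-8 log r) / (4 √n) = √(-log r) / √(2n)`.
      rw [show (-8 : ℝ) * Real.log r = 4 * (2 * (-Real.log r)) by ring,
        Real.sqrt_mul (by norm_num), Real.sqrt_mul (by norm_num),
        show (-(1 - 1 / 2) : ℝ) = -(1 / 2) by norm_num, Real.rpow_neg (by positivity),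
        ← Real.sqrt_eq_rpow, Real.sqrt_mul (by norm_num),
        show (4 : ℝ) = 2 ^ 2 by norm_num, Real.sqrt_sq (by norm_num)]
      have h3 : (0 : ℝ) < √2 := by positivity
      have h4 : 0 < √(n : ℝ) := Real.sqrt_pos.2 hn
      have h5 : √(2 : ℝ) ^ 2 = 2 := Real.sq_sqrt (by norm_num)
      field_simp
      rw [h5]
    · have h := hprofile h2 (2 - α) (by linarith) (Eventually.of_forall fun n => by
        rw [threshold, if_neg (by linarith), if_neg (by linarith), if_pos h1,
          show 2 - α - (1 - α / 2) = 1 - α / 2 by ring]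
        push_cast
        rw [Real.mul_rpow (z := 1 - α / 2) (by norm_num) (Nat.cast_nonneg n)]
        congr 2
        ring)
      rw [← hLsq]
      exact tendsto_sum_of_profile hα h2 hL (by simp)
        (hasDerivAt_rpow_profile (by linarith) _) hN h
  · obtain ⟨hc0, hc2, hc⟩ := cConst_spec hr
    have hth : ∀ n : ℕ, threshold 2 r n = cConst r * n := fun n => by
      rw [threshold, if_neg (lt_irrefl _), if_pos rfl]
    have htop : Tendsto (threshold 2 r) atTop atTop := by
      simp only [funext hth]
      exact tendsto_natCast_atTop_atTop.const_mul_atTop hc0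
    refine ⟨htop, fun a ha => ⟨?_, tendsto_sum_rpow_neg_zero (by norm_num)
      (tendsto_natCast_atTop_iff.1 (tendsto_atTop_of_abs_sub_le htop ha))⟩⟩
    rw [← hc]
    refine tendsto_sum_eq_two (by positivity) htop ha ?_ hN ?_
    -- As `c_r < 2`, the room `(2 - c_r) n` eventually exceeds the bounded shift.
    · have h3 : Tendsto (fun n : ℕ => (2 - cConst r) * (n : ℝ)) atTop atTop :=
        tendsto_natCast_atTop_atTop.const_mul_atTop (by linarith)
      filter_upwards [ha, h3.eventually_ge_atTop C] with n hn h4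
      have h5 := (abs_le.1 hn).2
      rw [hth] at h5
      have : (a n : ℝ) ≤ 2 * n := by linarith
      exact_mod_cast this
    · refine tendsto_const_nhds.congr' ?_
      filter_upwards [eventually_gt_atTop 0] with n hn
      have hn : (0 : ℝ) < n := Nat.cast_pos.2 hn
      rw [hth]
      push_cast
      field_simp
  · set K := (1 - α) / 2 * Real.log r with hKdef
    have hK0 : 0 < K := by
      rw [hKdef]
      exact mul_pos_of_neg_of_neg (by linarith) hlog
    have hα1 : 0 < α - 1 := by linarith
    have hth : ∀ n : ℕ, threshold α r n =
        ((2 * n : ℕ) : ℝ) ^ (1 / (α - 1)) * K ^ (1 / (1 - α)) := fun n => by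
      rw [threshold, if_pos h2]
      push_cast
      rfl
    have hKp : 0 < K ^ (1 / (1 - α)) := Real.rpow_pos_of_pos hK0 _
    have htop : Tendsto (threshold α r) atTop atTop := by
      simp only [funext hth]
      exact ((tendsto_rpow_atTop (by positivity)).comp hN').atTop_mul_const hKp
    have hratio : Tendsto (fun n => threshold α r n / ((2 * n : ℕ) : ℝ)) atTop (𝓝 0) := by
      have h3 : 1 / (α - 1) - 1 < 0 := by
        rw [sub_neg, div_lt_one hα1]
        linarith
      have h := (tendsto_rpow_zero_of_neg hN' h3).mul_const (K ^ (1 / (1 - α)))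
      rw [zero_mul] at h
      refine h.congr' ?_
      filter_upwards [hN'.eventually_gt_atTop 0] with n hn
      rw [hth, Real.rpow_sub_one hn.ne']
      ring
    refine ⟨htop, fun a ha => ⟨?_, tendsto_sum_rpow_neg_zero (by linarith)
      (tendsto_natCast_atTop_iff.1 (tendsto_atTop_of_abs_sub_le htop ha))⟩⟩
    have hlim : K / (α - 1) = -Real.log r / 2 := by
      rw [hKdef]
      field_simp
      ring
    rw [← hlim]
    refine tendsto_sum_gt_two h2 htop ha ?_ hN ?_
    · have h3 := (tendsto_div_one_of_abs_sub_le htop ha).mul hratio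
      rw [mul_zero] at h3
      filter_upwards [h3.eventually (gt_mem_nhds one_pos), hN'.eventually_gt_atTop 0,
        htop.eventually_gt_atTop 0] with n hn h4 h5
      rw [div_mul_div_cancel₀ h5.ne', div_lt_one h4] at hn
      exact_mod_cast hn.le
    · refine tendsto_const_nhds.congr' ?_
      filter_upwards [hN'.eventually_gt_atTop 0] with n hn
      have h3 : 1 / (α - 1) * (1 - α) = -1 := by
        field_simp
        ring
      have h4 : 1 / (1 - α) * (1 - α) = 1 := by
        rw [one_div_mul_cancel (by linarith)]
      rw [hth, Real.mul_rpow (by positivity) hKp.le, ← Real.rpow_mul hn.le, ← Real.rpow_mul hK0.le,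
        h3, h4, Real.rpow_neg_one, Real.rpow_one, ← mul_assoc, mul_inv_cancel₀ hn.ne', one_mul]

/-! ### Cell weights from the tail of the connection function. -/

/-- Bounds for the connection function at long distances. -/
theorem eventually_connection_bounds {α : ℝ} (hα : 0 < α) {g : ℝ → ℝ}
    (hg_tail : Tendsto (fun x : ℝ => g x / |x| ^ (-α)) (comap (fun x : ℝ => |x|) atTop) (𝓝 1))
    {ε : ℝ} (hε : 0 < ε) (hε1 : ε < 1) :
    ∃ R : ℝ, ∀ t : ℝ, R ≤ |t| → 1 - g t ≤ Real.exp (-((1 - ε) * |t| ^ (-α))) ∧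
      Real.exp (-((1 + ε) * |t| ^ (-α))) ≤ 1 - g t := by
  have h1 := hg_tail.eventually (Ioo_mem_nhds (show 1 - ε / 4 < 1 by linarith)
    (show (1 : ℝ) < 1 + ε / 4 by linarith))
  have h2 : ∀ᶠ t : ℝ in atTop, t ^ (-α) < ε / 4 :=
    (tendsto_rpow_neg_atTop hα).eventually (gt_mem_nhds (by linarith))
  rw [eventually_comap] at h1
  obtain ⟨R, hR⟩ := eventually_atTop.1 (h1.and (h2.and (eventually_gt_atTop 0)))
  refine ⟨R, fun t ht => ?_⟩
  obtain ⟨h3, h4, h5⟩ := hR |t| ht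
  obtain ⟨h6, h7⟩ := h3 t rfl
  set v := |t| ^ (-α) with hv
  have hv0 : 0 < v := Real.rpow_pos_of_pos h5 _
  rw [lt_div_iff₀ hv0] at h6
  rw [div_lt_iff₀ hv0] at h7
  constructor
  · have := Real.add_one_le_exp (-((1 - ε) * v))
    nlinarith
  · have h8 : 1 - g t ≥ 1 - (1 + ε / 4) * v := by linarith
    have h9 := Real.add_one_le_exp ((1 + ε) * v)
    rw [Real.exp_neg, inv_le_iff_one_le_mul₀ (Real.exp_pos _)]
    have h10 : 0 < 1 - (1 + ε / 4) * v := by nlinarith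
    -- The product is `1 + v (3ε/4 - (1 + ε/4)(1 + ε) v)`, and the bracket is nonnegative because `v
    -- < ε / 4` and `(1 + ε/4)(1 + ε) ≤ 3`.
    have h11 : 1 ≤ (1 - (1 + ε / 4) * v) * (1 + (1 + ε) * v) := by
      have : (1 + ε / 4) * (1 + ε) * v ≤ 3 * ε / 4 := by
        have : (1 + ε / 4) * (1 + ε) ≤ 3 := by nlinarith
        nlinarith
      nlinarith
    calc (1 : ℝ) ≤ (1 - (1 + ε / 4) * v) * (1 + (1 + ε) * v) := h11
      _ ≤ (1 - g t) * Real.exp ((1 + ε) * v) := by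
        refine mul_le_mul h8 (by linarith) (by positivity) (by linarith)

theorem sum_Ico_shift_lower {δ α ρ : ℝ} {m : ℕ} (f : ℕ → ℝ) :
    ∑ d ∈ Finset.Ico 1 m, f d * (if ρ + 1 ≤ d then δ * ((d : ℝ) + 1) ^ (-α) else 0) =
      δ * ∑ e ∈ Finset.Ioc (⌈ρ⌉₊ + 1) m, f (e - 1) * (e : ℝ) ^ (-α) := by
  simp only [mul_ite, mul_zero]
  rw [← Finset.sum_filter, Finset.mul_sum]
  refine Finset.sum_nbij' (fun d => d + 1) (fun e => e - 1) ?_ ?_ ?_ ?_ ?_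
  · intro d hd
    simp only [Finset.mem_filter, Finset.mem_Ico, Finset.mem_Ioc] at hd ⊢
    have : ⌈ρ⌉₊ ≤ d - 1 := Nat.ceil_le.2 (by rw [Nat.cast_sub hd.1.1]; push_cast; linarith)
    omega
  · intro e he
    simp only [Finset.mem_filter, Finset.mem_Ico, Finset.mem_Ioc] at he ⊢
    refine ⟨by omega, ?_⟩
    rw [Nat.cast_sub (by omega)]
    have h1 := Nat.le_ceil ρ
    have h2 : ((⌈ρ⌉₊ + 2 : ℕ) : ℝ) ≤ e := Nat.cast_le.2 he.1
    push_cast at h2 ⊢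
    linarith
  · intro d _
    simp
  · intro e he
    simp only [Finset.mem_Ioc] at he
    omega
  · intro d _
    simp only [Nat.add_sub_cancel]
    push_cast
    ring

/-- Substitute `e = d - 1`: the condition `ρ < d + 1` becomes `⌊ρ⌋₊ - 2 < e`. The hypothesis `2 ≤ ρ`
keeps both natural subtractions from truncating. -/
theorem sum_Ico_shift_upper {δ α ρ : ℝ} {m : ℕ} (hρ : 2 ≤ ρ) (f : ℕ → ℝ) :
    ∑ d ∈ Finset.Ico 1 (m + 1),
        f d * (if ρ < (d : ℝ) + 1 then δ * ((d - 1 : ℕ) : ℝ) ^ (-α) else 0) =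
      δ * ∑ e ∈ Finset.Ioo (⌊ρ⌋₊ - 2) m, f (e + 1) * (e : ℝ) ^ (-α) := by
  have hfl : 2 ≤ ⌊ρ⌋₊ := Nat.le_floor (by exact_mod_cast hρ)
  simp only [mul_ite, mul_zero]
  rw [← Finset.sum_filter, Finset.mul_sum]
  refine Finset.sum_nbij' (fun d => d - 1) (fun e => e + 1) ?_ ?_ ?_ ?_ ?_
  · intro d hd
    simp only [Finset.mem_filter, Finset.mem_Ico, Finset.mem_Ioo] at hd ⊢
    have h1 : ⌊ρ⌋₊ < d + 1 := (Nat.floor_lt (by linarith)).2 (by exact_mod_cast hd.2)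
    omega
  · intro e he
    simp only [Finset.mem_filter, Finset.mem_Ico, Finset.mem_Ioo] at he ⊢
    refine ⟨by omega, ?_⟩
    have h1 := Nat.lt_floor_add_one ρ
    have h2 : ((⌊ρ⌋₊ + 1 : ℕ) : ℝ) ≤ ((e + 2 : ℕ) : ℝ) := Nat.cast_le.2 (by omega)
    push_cast at h2 ⊢
    linarith
  · intro d hd
    simp only [Finset.mem_filter, Finset.mem_Ico] at hd
    omega
  · intro e _
    simp
  · intro d hd
    simp only [Finset.mem_filter, Finset.mem_Ico] at hd
    rw [Nat.sub_add_cancel hd.1.1]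
    ring

theorem tendsto_lower_weights {α : ℝ} {ρ : ℕ → ℝ} (δ : ℝ) {c : ℝ}
    (hρ : Tendsto ρ atTop atTop)
    (h : ∀ a : ℕ → ℕ, (∀ᶠ n in atTop, |(a n : ℝ) - ρ n| ≤ 3) →
      Tendsto (fun n => ∑ e ∈ Finset.Ioc (a n) (2 * n),
        (((2 * n : ℕ) : ℝ) - e) * (e : ℝ) ^ (-α)) atTop (𝓝 c) ∧
      Tendsto (fun n => ∑ e ∈ Finset.Ioc (a n) (2 * n), (e : ℝ) ^ (-α)) atTop (𝓝 0)) :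
    Tendsto (fun n => ∑ d ∈ Finset.Ico (1 : ℕ) (2 * n), (((2 * n : ℕ) : ℝ) - d) *
      (if ρ n + 1 ≤ d then δ * ((d : ℝ) + 1) ^ (-α) else 0)) atTop (𝓝 (δ * c)) ∧
    Tendsto (fun n => ∑ d ∈ Finset.Ico (1 : ℕ) (2 * n),
      (if ρ n + 1 ≤ d then δ * ((d : ℝ) + 1) ^ (-α) else 0)) atTop (𝓝 0) := by
  obtain ⟨hS, hA⟩ := h (fun n => ⌈ρ n⌉₊ + 1) (by
    filter_upwards [hρ.eventually_ge_atTop 0] with n hn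
    have h1 := Nat.le_ceil (ρ n)
    have h2 := Nat.ceil_lt_add_one hn
    push_cast
    rw [abs_le]
    constructor <;> linarith)
  constructor
  -- With `d = e - 1` the multiplicity is `2n - d = (2n - e) + 1`; the extra 1 contributes the total
  -- mass, which vanishes.
  · have h1 := (hS.add hA).const_mul δ
    rw [add_zero] at h1
    refine h1.congr fun n => ?_
    rw [sum_Ico_shift_lower fun d => ((2 * n : ℕ) : ℝ) - d, ← Finset.sum_add_distrib]
    congr 1
    refine Finset.sum_congr rfl fun e he => ?_
    rw [Finset.mem_Ioc] at he
    rw [Nat.cast_sub (by omega)]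
    push_cast
    ring
  · have h1 := hA.const_mul δ
    rw [mul_zero] at h1
    refine h1.congr fun n => ?_
    have := sum_Ico_shift_lower (δ := δ) (α := α) (ρ := ρ n) (m := 2 * n) fun _ => 1
    simp only [one_mul] at this
    exact this.symm

theorem tendsto_upper_weights {α : ℝ} {ρ : ℕ → ℝ} {δ : ℝ} (hδ : 0 ≤ δ) {c : ℝ}
    (hρ : Tendsto ρ atTop atTop)
    (h : ∀ a : ℕ → ℕ, (∀ᶠ n in atTop, |(a n : ℝ) - ρ n| ≤ 3) →
      Tendsto (fun n => ∑ e ∈ Finset.Ioc (a n) (2 * n),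
        (((2 * n : ℕ) : ℝ) - e) * (e : ℝ) ^ (-α)) atTop (𝓝 c) ∧
      Tendsto (fun n => ∑ e ∈ Finset.Ioc (a n) (2 * n), (e : ℝ) ^ (-α)) atTop (𝓝 0)) :
    Tendsto (fun n => ∑ d ∈ Finset.Ico (1 : ℕ) (2 * n + 1), (((2 * n + 1 : ℕ) : ℝ) - d) *
      (if ρ n < (d : ℝ) + 1 then δ * ((d - 1 : ℕ) : ℝ) ^ (-α) else 0)) atTop (𝓝 (δ * c)) ∧
    Tendsto (fun n => ∑ d ∈ Finset.Ico (1 : ℕ) (2 * n + 1),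
      (if ρ n < (d : ℝ) + 1 then δ * ((d - 1 : ℕ) : ℝ) ^ (-α) else 0)) atTop (𝓝 0) := by
  obtain ⟨hS, hA⟩ := h (fun n => ⌊ρ n⌋₊ - 2) (by
    filter_upwards [hρ.eventually_ge_atTop 2] with n hn
    have h1 := Nat.floor_le (show 0 ≤ ρ n by linarith)
    have h2 := Nat.lt_floor_add_one (ρ n)
    have hfl : 2 ≤ ⌊ρ n⌋₊ := Nat.le_floor (by exact_mod_cast hn)
    rw [Nat.cast_sub hfl]
    push_cast
    rw [abs_le]
    constructor <;> linarith)
  constructor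
  · refine (hS.const_mul δ).congr' ?_
    filter_upwards [hρ.eventually_ge_atTop 2] with n hn
    rw [sum_Ico_shift_upper hn fun d => ((2 * n + 1 : ℕ) : ℝ) - d]
    congr 1
    symm
    -- The added term `e = 2 * n` has multiplicity 0.
    refine (Finset.sum_subset Finset.Ioo_subset_Ioc_self fun e he he' => ?_).trans
      (Finset.sum_congr rfl fun e he => ?_)
    · have : e = 2 * n := by
        simp only [Finset.mem_Ioc, Finset.mem_Ioo] at he he'
        omega
      rw [this]
      push_cast
      ring
    · push_cast
      ring
  · have h1 := hA.const_mul δ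
    rw [mul_zero] at h1
    refine tendsto_of_tendsto_of_tendsto_of_le_of_le' tendsto_const_nhds h1 ?_ ?_
    · refine Eventually.of_forall fun n => Finset.sum_nonneg fun d _ => ?_
      split_ifs
      · exact mul_nonneg hδ (Real.rpow_nonneg (Nat.cast_nonneg _) _)
      · exact le_rfl
    · filter_upwards [hρ.eventually_ge_atTop 2] with n hn
      have h2 := sum_Ico_shift_upper (δ := δ) (α := α) (m := 2 * n) hn fun _ => 1
      simp only [one_mul] at h2
      rw [h2]
      refine mul_le_mul_of_nonneg_left ?_ hδ
      exact Finset.sum_le_sum_of_subset_of_nonneg Finset.Ioo_subset_Ioc_self fun e _ _ =>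
        Real.rpow_nonneg (Nat.cast_nonneg _) _

/-! ### Squeezing the probability and letting `ε → 0`. -/

theorem mainTheorem3 {Ω : Type*} [MeasurableSpace Ω] (μ : Measure Ω) [IsProbabilityMeasure μ]
    (α : ℝ) (hα : 0 < α)
    (g : ℝ → ℝ) (hg_meas : Measurable g) (hg_range : ∀ x, g x ∈ Set.Icc (0 : ℝ) 1)
    (hg_symm : ∀ x, g (-x) = g x)
    (hg_tail : Tendsto (fun x : ℝ => g x / |x| ^ (-α)) (comap (fun x : ℝ => |x|) atTop) (𝓝 1))
    (P : Ω → Set ℝ) (G : ℕ → Ω → RealGraph) (hG : IsSoftRandomGeometricGraph P G g μ)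
    (r : ℝ) (hr : r ∈ Set.Ioo (0 : ℝ) 1) :
    Tendsto (fun n : ℕ => μ.real {ω | longestEdge (G n ω) ≤ threshold α r n}) atTop
      (𝓝 (r ^ (1 / 2 : ℝ))) := by
  -- The shift 3 covers both cut-offs, `⌈ρ⌉₊ + 1` and `⌊ρ⌋₊ - 2`.
  obtain ⟨htop, hasymp⟩ := threshold_asymptotics hα hr 3
  set ρ := threshold α r with hρdef
  set c := -Real.log r / 2 with hc
  have hrc : r ^ (1 / 2 : ℝ) = Real.exp (-c) := by
    rw [Real.rpow_def_of_pos hr.1, hc]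
    congr 1
    ring
  have hX : ∀ n : ℕ, IsUnitPoissonLike (fun a ω => cellCount (P ω) n a) μ := fun n =>
    hG.poisson.isUnitPoissonLike_cellCount n
  have hupper : ∀ ε : ℝ, 0 < ε → ε < 1 → ∃ F : ℕ → ℝ,
      Tendsto F atTop (𝓝 (Real.exp (-((1 - ε) * c)))) ∧
      ∀ᶠ n in atTop, μ.real {ω | longestEdge (G n ω) ≤ ρ n} ≤ F n := by
    intro ε hε hε1
    obtain ⟨R, hR⟩ := eventually_connection_bounds hα hg_tail hε hε1
    -- An underestimate: only cell differences that force a distance above `ρ`, each with the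
    -- largest possible distance `d + 1`.
    set w : ℕ → ℕ → ℝ := fun n d =>
      if ρ n + 1 ≤ d then (1 - ε) * ((d : ℝ) + 1) ^ (-α) else 0 with hw
    have hw0 : ∀ n d, 0 ≤ w n d := fun n d => by
      simp only [hw]
      split_ifs
      · exact mul_nonneg (by linarith) (Real.rpow_nonneg (by positivity) _)
      · exact le_rfl
    obtain ⟨hmean, hmass⟩ := tendsto_lower_weights (1 - ε) htop hasymp
    refine ⟨_, tendsto_integral_exp_neg_pairSum hX hw0 hmean hmass, ?_⟩
    filter_upwards [htop.eventually_ge_atTop R, htop.eventually_gt_atTop 0] with n hn h0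
    refine hG.measureReal_longestEdge_le_le hg_meas hg_range n h0.le (hw0 n) fun d t h1 h2 => ?_
    simp only [hw]
    split_ifs with h3 h4 h4
    · refine (hR t (by linarith)).1.trans (Real.exp_le_exp.2 (neg_le_neg ?_))
      refine mul_le_mul_of_nonneg_left ?_ (by linarith)
      exact Real.rpow_le_rpow_of_nonpos (by linarith) h2.le (by linarith)
    · simpa using (hg_range t).1
    · linarith
    · simp
  have hlower : ∀ ε : ℝ, 0 < ε → ε < 1 → ∃ F : ℕ → ℝ,
      Tendsto F atTop (𝓝 (Real.exp (-((1 + ε) * c)))) ∧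
      ∀ᶠ n in atTop, F n ≤ μ.real {ω | longestEdge (G n ω) ≤ ρ n} := by
    intro ε hε hε1
    obtain ⟨R, hR⟩ := eventually_connection_bounds hα hg_tail hε hε1
    -- An overestimate: every cell difference that allows a distance above `ρ`, each with the
    -- smallest possible distance `d - 1`. Once `ρ ≥ 2`, only `d ≥ 2` occurs and the base is
    -- positive.
    set w : ℕ → ℕ → ℝ := fun n d =>
      if ρ n < (d : ℝ) + 1 then (1 + ε) * ((d - 1 : ℕ) : ℝ) ^ (-α) else 0 with hw
    have hw0 : ∀ n d, 0 ≤ w n d := fun n d => by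
      simp only [hw]
      split_ifs
      · exact mul_nonneg (by linarith) (Real.rpow_nonneg (Nat.cast_nonneg _) _)
      · exact le_rfl
    obtain ⟨hmean, hmass⟩ := tendsto_upper_weights (δ := 1 + ε) (by linarith) htop hasymp
    refine ⟨_, tendsto_integral_exp_neg_pairSum hX hw0 hmean hmass, ?_⟩
    filter_upwards [htop.eventually_ge_atTop R, htop.eventually_ge_atTop 2] with n hn h0
    refine hG.le_measureReal_longestEdge_le hg_meas hg_range n (by linarith) (hw0 n)
      fun d t h1 h2 => ?_
    split_ifs with h3
    · refine le_trans (Real.exp_le_exp.2 (neg_le_neg ?_)) (hR t (by linarith)).2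
      have hd : 2 ≤ d := by
        have : (1 : ℝ) < d := by linarith
        exact_mod_cast this
      simp only [hw]
      rw [if_pos (by linarith), Nat.cast_sub (by omega)]
      have hd' : (2 : ℝ) ≤ d := by exact_mod_cast hd
      refine mul_le_mul_of_nonneg_left ?_ (by linarith)
      push_cast
      exact Real.rpow_le_rpow_of_nonpos (by linarith) h1.le (by linarith)
    · exact Real.exp_le_one_iff.2 (by linarith [hw0 n d])
  rw [hrc]
  have hε0 : Tendsto (fun ε : ℝ => ε) (𝓝[>] 0) (𝓝 0) := tendsto_id.mono_left nhdsWithin_le_nhds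
  have hsmall : ∀ᶠ ε : ℝ in 𝓝[>] 0, 0 < ε ∧ ε < 1 := Ioo_mem_nhdsGT one_pos
  refine tendsto_order.2 ⟨fun b hb => ?_, fun b hb => ?_⟩
  · have h1 : Tendsto (fun ε : ℝ => Real.exp (-((1 + ε) * c))) (𝓝[>] 0) (𝓝 (Real.exp (-c))) := by
      have : ContinuousAt (fun ε : ℝ => Real.exp (-((1 + ε) * c))) 0 := by fun_prop
      simpa [Function.comp_def] using this.tendsto.comp hε0
    obtain ⟨ε, h2, h3⟩ := ((h1.eventually (lt_mem_nhds hb)).and hsmall).exists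
    obtain ⟨F, hF, hle⟩ := hlower ε h3.1 h3.2
    filter_upwards [hF.eventually (lt_mem_nhds h2), hle] with n h4 h5
    exact h4.trans_le h5
  · have h1 : Tendsto (fun ε : ℝ => Real.exp (-((1 - ε) * c))) (𝓝[>] 0) (𝓝 (Real.exp (-c))) := by
      have : ContinuousAt (fun ε : ℝ => Real.exp (-((1 - ε) * c))) 0 := by fun_prop
      simpa [Function.comp_def] using this.tendsto.comp hε0
    obtain ⟨ε, h2, h3⟩ := ((h1.eventually (gt_mem_nhds hb)).and hsmall).exists
    obtain ⟨F, hF, hle⟩ := hupper ε h3.1 h3.2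
    filter_upwards [hF.eventually (gt_mem_nhds h2), hle] with n h4 h5
    exact h5.trans_lt h4
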